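/- Let $c_1>c_2>1$, $0<\alpha<1$ and $\Delta>0$ be real numbers. There exist a constant $\gamma>0$ and a deterministic algorithm, both depending only on $c_1,c_2,\alpha,\Delta$, with the following property. Given any graph $G=(V,E)$ on $n\ge 1$ vertices with maximum degree at most $\Delta$ and $|E|/|V|\ge c_1$, the algorithm finds, in time polynomial in $n$, one of the following, and declares which of the two it has found: (i) a nonempty vertex set $W\subseteq V$ with $|W|\le\alpha n$ that spans at least $c_2|W|$ edges of $G$; or (ii) a vertex set $V^*\subseteq V$ with $|V^*|\ge\alpha n$ such that the induced subgraph $G^*=G[V^*]$ is a $\gamma$-expander. Here a finite graph $H$ is called a $\gamma$-expander if $|N_H(W)|\ge\gamma|W|$ for every $W\subseteq V(H)$ with $|W|\le|V(H)|/2$, where $N_H(W)$ is the set of vertices outside $W$ that have a neighbour in $W$. -/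

import Mathlib

/-! ### Expanders -/

open Classical in
/-- The external neighbourhood `N_G(W)`: the vertices outside `W` with a neighbour in `W`. -/
noncomputable def extNeighbors {V : Type*} [Fintype V] (G : SimpleGraph V) (W : Finset V) :
    Finset V :=
  Finset.univ.filter fun v => v ∉ W ∧ ∃ w ∈ W, G.Adj w v

/-- `G` is a `γ`-expander: `|N_G(W)| ≥ γ |W|` for every vertex set `W` with `|W| ≤ |V| / 2`. -/
def IsExpander {V : Type*} [Fintype V] (G : SimpleGraph V) (γ : ℝ) : Prop :=
  ∀ W : Finset V, (W.card : ℝ) ≤ (Fintype.card V : ℝ) / 2 →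
    γ * (W.card : ℝ) ≤ ((extNeighbors G W).card : ℝ)

/-- The number of edges of `G` spanned by the vertex set `W`. -/
noncomputable def spannedEdges {V : Type*} (G : SimpleGraph V) (W : Finset V) : ℕ :=
  (G.induce (W : Set V)).edgeSet.ncard

/-! ### Random access machines

Programs for a random access machine with natural-number registers, and with memory that is
addressed indirectly through registers.  The only arithmetic operations are addition and truncated
subtraction, so that the unit-cost step count is polynomially equivalent to the time of a
Turing machine. -/

namespace RAM

/-- A memory configuration: the registers and the memory banks
(`mem b a` is the cell with address `a` in bank `b`). -/
structure State where
  reg : ℕ → ℕ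
  mem : ℕ → ℕ → ℕ

/-- Structured programs.  All register indices, bank indices and constants are fixed in the
program text; only memory addresses are computed at run time. -/
inductive Program where
  /-- `reg x := c` -/
  | const (x c : ℕ)
  /-- `reg x := reg y + reg z` -/
  | add (x y z : ℕ)
  /-- `reg x := max (reg y - reg z) 0` -/
  | sub (x y z : ℕ)
  /-- `reg x := mem b (reg y)` -/
  | load (x b y : ℕ)
  /-- `mem b (reg y) := reg x` -/
  | store (b y x : ℕ)
  /-- run `p`, then `q` -/
  | seq (p q : Program)
  /-- if `reg x ≠ 0` run `p`, else run `q` -/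
  | ite (x : ℕ) (p q : Program)
  /-- as long as `reg x ≠ 0`, run `p` -/
  | loop (x : ℕ) (p : Program)

/-- Assignment to a register. -/
def State.setReg (s : State) (x v : ℕ) : State :=
  { s with reg := Function.update s.reg x v }

/-- Assignment to a memory cell. -/
def State.setMem (s : State) (b a v : ℕ) : State :=
  { s with mem := Function.update s.mem b (Function.update (s.mem b) a v) }

/-- `Exec p s s' t`: started in `s`, the program `p` halts in `s'` after exactly `t` steps.
Every elementary instruction and every test takes one step. -/
inductive Exec : Program → State → State → ℕ → Prop
  | const (x c : ℕ) (s : State) : Exec (.const x c) s (s.setReg x c) 1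
  | add (x y z : ℕ) (s : State) : Exec (.add x y z) s (s.setReg x (s.reg y + s.reg z)) 1
  | sub (x y z : ℕ) (s : State) : Exec (.sub x y z) s (s.setReg x (s.reg y - s.reg z)) 1
  | load (x b y : ℕ) (s : State) : Exec (.load x b y) s (s.setReg x (s.mem b (s.reg y))) 1
  | store (b y x : ℕ) (s : State) : Exec (.store b y x) s (s.setMem b (s.reg y) (s.reg x)) 1
  | seq {p q : Program} {s s' s'' : State} {t t' : ℕ} :
      Exec p s s' t → Exec q s' s'' t' → Exec (.seq p q) s s'' (t + t')
  | iteTrue {x : ℕ} {p q : Program} {s s' : State} {t : ℕ} :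
      s.reg x ≠ 0 → Exec p s s' t → Exec (.ite x p q) s s' (1 + t)
  | iteFalse {x : ℕ} {p q : Program} {s s' : State} {t : ℕ} :
      s.reg x = 0 → Exec q s s' t → Exec (.ite x p q) s s' (1 + t)
  | loopStop {x : ℕ} {p : Program} {s : State} :
      s.reg x = 0 → Exec (.loop x p) s s 1
  | loopStep {x : ℕ} {p : Program} {s s' s'' : State} {t t' : ℕ} :
      s.reg x ≠ 0 → Exec p s s' t → Exec (.loop x p) s' s'' t' →
        Exec (.loop x p) s s'' (1 + t + t')

/-- The machine is deterministic. -/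
theorem Exec.deterministic {p : Program} {s s₁ s₂ : State} {t₁ t₂ : ℕ}
    (h₁ : Exec p s s₁ t₁) (h₂ : Exec p s s₂ t₂) : s₁ = s₂ ∧ t₁ = t₂ := by
  induction h₁ generalizing s₂ t₂ with
  | const | add | sub | load | store => cases h₂; exact ⟨rfl, rfl⟩
  | seq _ _ ih ih' =>
    cases h₂ with
    | seq a b =>
      obtain ⟨rfl, rfl⟩ := ih a
      obtain ⟨rfl, rfl⟩ := ih' b
      exact ⟨rfl, rfl⟩
  | iteTrue h _ ih =>
    cases h₂ with
    | iteTrue _ a => obtain ⟨rfl, rfl⟩ := ih a; exact ⟨rfl, rfl⟩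
    | iteFalse h' _ => exact absurd h' h
  | iteFalse h _ ih =>
    cases h₂ with
    | iteTrue h' _ => exact absurd h h'
    | iteFalse _ a => obtain ⟨rfl, rfl⟩ := ih a; exact ⟨rfl, rfl⟩
  | loopStop h =>
    cases h₂ with
    | loopStop _ => exact ⟨rfl, rfl⟩
    | loopStep h' _ _ => exact absurd h h'
  | loopStep h _ _ ih ih' =>
    cases h₂ with
    | loopStop h' => exact absurd h' h
    | loopStep _ a b =>
      obtain ⟨rfl, rfl⟩ := ih a
      obtain ⟨rfl, rfl⟩ := ih' b
      exact ⟨rfl, rfl⟩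

/-- The input configuration for a graph on the vertices `0, …, n - 1`: register `0` holds `n`,
bank `0` holds the `n × n` adjacency matrix row by row, everything else is `0`. -/
def graphInput {n : ℕ} (G : SimpleGraph (Fin n)) [DecidableRel G.Adj] : State where
  reg := fun x => if x = 0 then n else 0
  mem := fun b a =>
    if b = 0 ∧ ∃ i j : Fin n, a = (i : ℕ) * n + (j : ℕ) ∧ G.Adj i j then 1 else 0

/-- The vertex set written by the machine: the vertices `v` whose cell in bank `1` is nonzero. -/
def outputSet (n : ℕ) (s : State) : Finset (Fin n) :=
  Finset.univ.filter fun v => s.mem 1 (v : ℕ) ≠ 0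

/-- The verdict of the machine, read off register `0`: `true` (nonzero) announces that the output
is the vertex set of an expander, `false` (zero) that it is a small and dense set. -/
def announcesExpander (s : State) : Prop := s.reg 0 ≠ 0

end RAM

/-! Let `D` be an integer bound for the degrees. The algorithm keeps a vertex set `U` and a
threshold `thr` with `e(U) ≥ (thr / q) |U|`; it starts with `U = V` and `thr = C = ⌊q c₁⌋`. As long
as `U` has more than about `α n` vertices, it looks for a sparse cut: a set `W ⊆ U` with `|W| ≤ |U|
/ 2` that sends fewer than `|W| / q` edges to `U \ W`. If `e(W) ≥ ((thr - 1) / q) |W|`, it continues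
with `W` and `thr - 1`. Otherwise it discards `W`; inside `W` and across the cut there are fewer
than `(thr / q) |W|` edges, so `U \ W` keeps the density `thr / q` (`splitStmt_running`). The first
case halves the set and so happens at most `H` times, where `2 ^ H > 1 / α`. Since `q` is large, the
density stays above `c₂ + 1 / q`. A set `U` that has become small is therefore dense, and a large
`U` without a detected cut must be shown to expand.

Cuts are detected by sweeping over the level sets of the iterates of `M = 2 D - L`, `L` being the
Laplacian of `G[U]`, started from every unit vector; this is exact arithmetic with natural numbers.
If no level set is sparse, a Cheeger argument (`sum_sub_sq_le_energy`) bounds the growth of the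
squared distance from the mean by the factor `4 D² - 1 / q²` per step. A set `S` of at most half of
the vertices with `|S| > 16 D q² e(S, U \ S)` would have a centred indicator whose squared norm
grows by at least `4 D² - 1 / (2 q²)` per step. This indicator is a combination of centred unit
vectors, so the two rates contradict each other after `8 D² q² n` steps
(`card_le_arcs_of_levelsExpand`). A failed search thus certifies edge expansion, and vertex
expansion follows from the degree bound.

The real number `α` is replaced by rational bounds `a / Q ≤ α ≤ b / Q` (`exists_rational_window`). A
set with at most `b n / Q` vertices is trimmed to at most `a n / Q` vertices, and the slack `1 / q`
in the density pays for the lost edges. The running time is polynomial because the program is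
compiled from a language with bounded loops only (`Stmt.runs`). -/

/-! ### A small structured language compiled to random access machines -/

namespace RAM

/-- Execution within a time bound, with a postcondition. -/
def Runs (p : Program) (s : State) (c : ℕ) (Q : State → Prop) : Prop :=
  ∃ s' t, Exec p s s' t ∧ t ≤ c ∧ Q s'

theorem Runs.mono {p : Program} {s : State} {c c' : ℕ} {Q Q' : State → Prop}
    (h : Runs p s c Q) (hc : c ≤ c') (hQ : ∀ s', Q s' → Q' s') : Runs p s c' Q' := by
  obtain ⟨s', t, he, ht, hq⟩ := h
  exact ⟨s', t, he, ht.trans hc, hQ _ hq⟩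

theorem Runs.seq {p q : Program} {s : State} {c d : ℕ} {Q R : State → Prop}
    (hp : Runs p s c R) (hq : ∀ s', R s' → Runs q s' d Q) : Runs (.seq p q) s (c + d) Q := by
  obtain ⟨s', t, he, ht, hr⟩ := hp
  obtain ⟨s'', t', he', ht', hQ⟩ := hq s' hr
  exact ⟨s'', t + t', .seq he he', by omega, hQ⟩

theorem Runs.const {x c : ℕ} {s : State} {Q : State → Prop} (h : Q (s.setReg x c)) :
    Runs (.const x c) s 1 Q := ⟨_, _, .const x c s, le_rfl, h⟩

theorem Runs.add {x y z : ℕ} {s : State} {Q : State → Prop}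
    (h : Q (s.setReg x (s.reg y + s.reg z))) : Runs (.add x y z) s 1 Q :=
  ⟨_, _, .add x y z s, le_rfl, h⟩

theorem Runs.sub {x y z : ℕ} {s : State} {Q : State → Prop}
    (h : Q (s.setReg x (s.reg y - s.reg z))) : Runs (.sub x y z) s 1 Q :=
  ⟨_, _, .sub x y z s, le_rfl, h⟩

theorem Runs.load {x b y : ℕ} {s : State} {Q : State → Prop}
    (h : Q (s.setReg x (s.mem b (s.reg y)))) : Runs (.load x b y) s 1 Q :=
  ⟨_, _, .load x b y s, le_rfl, h⟩

theorem Runs.store {b y x : ℕ} {s : State} {Q : State → Prop}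
    (h : Q (s.setMem b (s.reg y) (s.reg x))) : Runs (.store b y x) s 1 Q :=
  ⟨_, _, .store b y x s, le_rfl, h⟩

theorem Runs.ite {x : ℕ} {p q : Program} {s : State} {c : ℕ} {Q : State → Prop}
    (hp : s.reg x ≠ 0 → Runs p s c Q) (hq : s.reg x = 0 → Runs q s c Q) :
    Runs (.ite x p q) s (1 + c) Q := by
  by_cases h : s.reg x = 0
  · obtain ⟨s', t, he, ht, hQ⟩ := hq h
    exact ⟨s', 1 + t, .iteFalse h he, by omega, hQ⟩
  · obtain ⟨s', t, he, ht, hQ⟩ := hp h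
    exact ⟨s', 1 + t, .iteTrue h he, by omega, hQ⟩

/-- A loop whose counter `r` goes down by one in every round. -/
theorem Runs.loop {r : ℕ} {p : Program} {c : ℕ} (I : ℕ → State → Prop)
    (hr : ∀ k s, I k s → s.reg r = k)
    (hp : ∀ k s, I (k + 1) s → Runs p s c (I k)) :
    ∀ k s, I k s → Runs (.loop r p) s (k * (c + 1) + 1) (I 0) := by
  intro k
  induction k with
  | zero => intro s hs; exact ⟨s, 1, .loopStop (hr _ _ hs), by omega, hs⟩
  | succ k ih =>
    intro s hs
    obtain ⟨s', t, he, ht, hs'⟩ := hp k s hs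
    obtain ⟨s'', t', he', ht', hs''⟩ := ih s' hs'
    refine ⟨s'', 1 + t + t', .loopStep (by rw [hr _ _ hs]; omega) he he', ?_, hs''⟩
    rw [Nat.succ_mul]; omega

@[simp] theorem State.reg_setReg (s : State) (x v : ℕ) :
    (s.setReg x v).reg = Function.update s.reg x v := rfl

@[simp] theorem State.mem_setReg (s : State) (x v : ℕ) : (s.setReg x v).mem = s.mem := rfl

@[simp] theorem State.reg_setMem (s : State) (b a v : ℕ) : (s.setMem b a v).reg = s.reg := rfl

@[simp] theorem State.mem_setMem (s : State) (b a v : ℕ) : (s.setMem b a v).mem =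
    Function.update s.mem b (Function.update (s.mem b) a v) := rfl

end RAM

/-! ### Expressions and statements with bounded loops, and the correctness of their compilation. -/

namespace Lang

open RAM Polynomial

/-- The contents of the memory banks. -/
abbrev Mem := ℕ → ℕ → ℕ

/-- Push a value on a stack of loop indices. -/
def push (k : ℕ) (v : ℕ → ℕ) : ℕ → ℕ
  | 0 => k
  | i + 1 => v i

@[simp] theorem push_zero (k : ℕ) (v : ℕ → ℕ) : push k v 0 = k := rfl

@[simp] theorem push_one (k : ℕ) (v : ℕ → ℕ) : push k v 1 = v 0 := rfl

/-- Expressions with de Bruijn indices for the indices of the enclosing loops and sums. -/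
inductive Expr where
  /-- the input size -/
  | size
  | lit (c : ℕ)
  | var (i : ℕ)
  | load (b : ℕ) (a : Expr)
  | add (a b : Expr)
  | sub (a b : Expr)
  /-- the value of `p` if `c` is nonzero, else that of `q` -/
  | ite (c p q : Expr)
  /-- the sum of `e` over all indices below the input size -/
  | sum (e : Expr)
  /-- the sum of `e` over all indices below `c` -/
  | sumLit (c : ℕ) (e : Expr)

/-- The value of an expression. -/
def Expr.eval (n : ℕ) : Expr → (ℕ → ℕ) → Mem → ℕ
  | .size, _, _ => n
  | .lit c, _, _ => c
  | .var i, v, _ => v i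
  | .load b a, v, m => m b (a.eval n v m)
  | .add a b, v, m => a.eval n v m + b.eval n v m
  | .sub a b, v, m => a.eval n v m - b.eval n v m
  | .ite c p q, v, m => if c.eval n v m ≠ 0 then p.eval n v m else q.eval n v m
  | .sum e, v, m => ∑ k ∈ Finset.range n, e.eval n (push k v) m
  | .sumLit c e, v, m => ∑ k ∈ Finset.range c, e.eval n (push k v) m

/-- The loop that adds up the values of `p` (found in register `e + 2`) in register `e`,
for the indices below the value of register `e + 1`. -/
def sumLoop (p : Program) (e : ℕ) : Program :=
  .loop (e + 1) (.seq (.const (e + 2) 1) (.seq (.sub (e + 1) (e + 1) (e + 2))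
    (.seq p (.add e e (e + 2)))))

/-- Code that leaves the value of the expression in register `e`, uses no register below `e`,
and finds the index `i` in register `ρ i`. -/
def Expr.compile : Expr → (ρ : ℕ → ℕ) → (e : ℕ) → Program
  | .size, _, e => .seq (.const e 0) (.add e 0 e)
  | .lit c, _, e => .const e c
  | .var i, ρ, e => .seq (.const e 0) (.add e (ρ i) e)
  | .load b a, ρ, e => .seq (a.compile ρ e) (.load e b e)
  | .add a b, ρ, e => .seq (a.compile ρ e) (.seq (b.compile ρ (e + 1)) (.add e e (e + 1)))
  | .sub a b, ρ, e => .seq (a.compile ρ e) (.seq (b.compile ρ (e + 1)) (.sub e e (e + 1)))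
  | .ite c p q, ρ, e => .seq (c.compile ρ e) (.ite e (p.compile ρ e) (q.compile ρ e))
  | .sum b, ρ, e => .seq (.const e 0) (.seq (.add (e + 1) 0 e)
      (sumLoop (b.compile (push (e + 1) ρ) (e + 2)) e))
  | .sumLit c b, ρ, e => .seq (.const e 0) (.seq (.const (e + 1) c)
      (sumLoop (b.compile (push (e + 1) ρ) (e + 2)) e))

/-- A bound for the running time of an expression, as a polynomial in the input size. -/
noncomputable def Expr.cost : Expr → ℕ[X]
  | .size => 2
  | .lit _ => 1
  | .var _ => 2
  | .load _ a => a.cost + 1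
  | .add a b => a.cost + (b.cost + 1)
  | .sub a b => a.cost + (b.cost + 1)
  | .ite c p q => c.cost + (1 + (p.cost + q.cost))
  | .sum b => 1 + (1 + (X * ((1 + (1 + (b.cost + 1))) + 1) + 1))
  | .sumLit c b => 1 + (1 + ((c : ℕ[X]) * ((1 + (1 + (b.cost + 1))) + 1) + 1))

/-- The registers below `e` and the memory are unchanged. -/
def Keeps (e : ℕ) (s s' : State) : Prop := s'.mem = s.mem ∧ ∀ r < e, s'.reg r = s.reg r

/-- The counter drops before the body runs, so the body sees the indices `k - 1, …, 0`. The
invariant is that the accumulator plus the sum over the remaining indices is the full sum. -/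
theorem sumLoop_runs {p : Program} {c e k : ℕ} {f : ℕ → ℕ} {s₀ s : State}
    (hp : ∀ s k, Keeps e s₀ s → s.reg (e + 1) = k →
      Runs p s c fun s' => Keeps (e + 2) s s' ∧ s'.reg (e + 2) = f k)
    (hs : Keeps e s₀ s) (h0 : s.reg e = 0) (hk : s.reg (e + 1) = k) :
    Runs (sumLoop p e) s (k * ((1 + (1 + (c + 1))) + 1) + 1) fun s' =>
      Keeps e s₀ s' ∧ s'.reg e = ∑ i ∈ Finset.range k, f i := by
  refine (Runs.loop (fun j s => s.reg (e + 1) = j ∧ Keeps e s₀ s ∧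
    s.reg e + ∑ i ∈ Finset.range j, f i = ∑ i ∈ Finset.range k, f i) (fun _ _ h => h.1)
    ?_ k s ⟨hk, hs, by simp [h0]⟩).mono le_rfl ?_
  · rintro j s ⟨hj, hs, hsum⟩
    refine Runs.seq (.const (Q := fun s' => s' = s.setReg (e + 2) 1) rfl) ?_
    rintro _ rfl
    refine Runs.seq (.sub (Q := fun s' => Keeps e s₀ s' ∧ s'.reg (e + 1) = j ∧
      s'.reg e = s.reg e) ⟨⟨hs.1, fun r hr => ?_⟩, ?_, ?_⟩) ?_
    · simp [Function.update_of_ne (show r ≠ e + 1 by omega),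
        Function.update_of_ne (show r ≠ e + 2 by omega), hs.2 r hr]
    · simp [hj]
    · simp
    rintro s' ⟨hs', hj', he'⟩
    refine Runs.seq (hp s' j hs' hj') ?_
    rintro s'' ⟨hk'', hf⟩
    refine .add ⟨?_, ⟨hk''.1.trans hs'.1, fun r hr => ?_⟩, ?_⟩
    · simp [hk''.2 (e + 1) (by omega), hj']
    · simp [Function.update_of_ne (show r ≠ e by omega), hk''.2 r (by omega), hs'.2 r hr]
    · simp only [State.reg_setReg, Function.update_self, hk''.2 e (by omega), hf, he']
      rw [← hsum, Finset.sum_range_succ]; ring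
  · rintro s' ⟨-, h, hsum⟩
    exact ⟨h, by simpa using hsum⟩

theorem Keeps.trans {e e' : ℕ} {s s' s'' : State} (h : Keeps e s s') (h' : Keeps e' s' s'')
    (he : e ≤ e') : Keeps e s s'' :=
  ⟨h'.1.trans h.1, fun r hr => (h'.2 r (by omega)).trans (h.2 r hr)⟩

theorem Keeps.setReg {e x : ℕ} {s s' : State} (h : Keeps e s s') (hx : e ≤ x) (v : ℕ) :
    Keeps e s (s'.setReg x v) :=
  ⟨h.1, fun r hr => by simp [Function.update_of_ne (show r ≠ x by omega), h.2 r hr]⟩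

theorem Keeps.refl (e : ℕ) (s : State) : Keeps e s s := ⟨rfl, fun _ _ => rfl⟩

theorem Keeps.env {e : ℕ} {s s' : State} (h : Keeps e s s') {ρ : ℕ → ℕ} (hρ : ∀ i, ρ i < e) :
    (fun i => s'.reg (ρ i)) = fun i => s.reg (ρ i) := funext fun i => h.2 _ (hρ i)

/-- Registers form a stack: code at level `e` touches only registers from `e` on, so partial results
and indices of the enclosing code survive. The hypothesis `0 < e` protects register `0`, which holds
the input size. -/
theorem Expr.runs (n : ℕ) (a : Expr) : ∀ (ρ : ℕ → ℕ) (e : ℕ) (s : State), 0 < e →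
    (∀ i, ρ i < e) → s.reg 0 = n →
    Runs (a.compile ρ e) s (a.cost.eval n) fun s' =>
      Keeps e s s' ∧ s'.reg e = a.eval n (fun i => s.reg (ρ i)) s.mem := by
  have hbody : ∀ b : Expr, (∀ (ρ : ℕ → ℕ) (e : ℕ) (s : State), 0 < e →
      (∀ i, ρ i < e) → s.reg 0 = n → Runs (b.compile ρ e) s (b.cost.eval n) fun s' =>
        Keeps e s s' ∧ s'.reg e = b.eval n (fun i => s.reg (ρ i)) s.mem) →
      ∀ (ρ : ℕ → ℕ) (e : ℕ) (s₀ : State), 0 < e → (∀ i, ρ i < e) → s₀.reg 0 = n →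
      ∀ s k, Keeps e s₀ s → s.reg (e + 1) = k →
        Runs (b.compile (push (e + 1) ρ) (e + 2)) s (b.cost.eval n) fun s' =>
          Keeps (e + 2) s s' ∧
            s'.reg (e + 2) = b.eval n (push k fun i => s₀.reg (ρ i)) s₀.mem := by
    intro b hb ρ e s₀ he hρ hn s k hs hk
    refine (hb (push (e + 1) ρ) (e + 2) s (by omega) ?_ ((hs.2 0 he).trans hn)).mono le_rfl ?_
    · rintro (_ | i)
      · simp
      · exact (hρ i).trans (by omega)
    · rintro s' ⟨h, h'⟩
      refine ⟨h, h'.trans ?_⟩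
      rw [hs.1]
      congr 1
      funext i
      cases i with
      | zero => exact hk
      | succ i => exact hs.2 _ (hρ i)
  induction a with
  | size =>
    intro ρ e s he hρ hn
    refine (Runs.seq (d := 1) (.const (Q := fun s' => s' = s.setReg e 0) rfl) fun s' h' => .add
      (Q := fun s' => Keeps e s s' ∧ s'.reg e = _) ?_).mono
        (by simp [cost]) fun _ h => h
    subst h'
    refine ⟨((Keeps.refl e s).setReg le_rfl _).setReg le_rfl _, ?_⟩
    simp [eval, Function.update_of_ne he.ne, hn]
  | lit c =>
    intro ρ e s he hρ hn
    exact (Runs.const ⟨(Keeps.refl e s).setReg le_rfl _, by simp [eval]⟩).mono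
      (by simp [cost]) fun _ h => h
  | var i =>
    intro ρ e s he hρ hn
    refine (Runs.seq (d := 1) (.const (Q := fun s' => s' = s.setReg e 0) rfl) fun s' h' => .add
      (Q := fun s' => Keeps e s s' ∧ s'.reg e = _) ?_).mono
        (by simp [cost]) fun _ h => h
    subst h'
    refine ⟨((Keeps.refl e s).setReg le_rfl _).setReg le_rfl _, ?_⟩
    simp [eval, Function.update_of_ne (hρ i).ne]
  | load b a iha =>
    intro ρ e s he hρ hn
    refine (Runs.seq (iha ρ e s he hρ hn) (d := 1) ?_).mono (by simp [cost]) fun _ h => h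
    rintro s' ⟨h, h'⟩
    exact .load ⟨h.setReg le_rfl _, by simp [eval, h', h.1]⟩
  | add a b iha ihb =>
    intro ρ e s he hρ hn
    refine (Runs.seq (iha ρ e s he hρ hn) fun s' h => Runs.seq (d := 1)
      (ihb ρ (e + 1) s' (by omega) (fun i => (hρ i).trans (by omega)) ((h.1.2 0 he).trans hn))
      fun s'' h' => .add ⟨(h.1.trans h'.1 (by omega)).setReg le_rfl _, ?_⟩).mono
        (by simp [cost]) fun _ h => h
    simp [eval, h'.2, h'.1.2 e (by omega), h.2, h.1.env hρ, h.1.1]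
  | sub a b iha ihb =>
    intro ρ e s he hρ hn
    refine (Runs.seq (iha ρ e s he hρ hn) fun s' h => Runs.seq (d := 1)
      (ihb ρ (e + 1) s' (by omega) (fun i => (hρ i).trans (by omega)) ((h.1.2 0 he).trans hn))
      fun s'' h' => .sub ⟨(h.1.trans h'.1 (by omega)).setReg le_rfl _, ?_⟩).mono
        (by simp [cost]) fun _ h => h
    simp [eval, h'.2, h'.1.2 e (by omega), h.2, h.1.env hρ, h.1.1]
  | ite c p q ihc ihp ihq =>
    intro ρ e s he hρ hn
    refine (Runs.seq (ihc ρ e s he hρ hn)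
      (d := 1 + (p.cost.eval n + q.cost.eval n)) fun s' h => Runs.ite ?_ ?_).mono
        (by simp [cost]) fun _ h => h
    · intro hne
      refine (ihp ρ e s' he hρ ((h.1.2 0 he).trans hn)).mono (by omega) fun s'' h' =>
        ⟨h.1.trans h'.1 le_rfl, ?_⟩
      rw [h'.2, h.1.env hρ, h.1.1, eval, if_pos (h.2 ▸ hne)]
    · intro hne
      refine (ihq ρ e s' he hρ ((h.1.2 0 he).trans hn)).mono (by omega) fun s'' h' =>
        ⟨h.1.trans h'.1 le_rfl, ?_⟩
      rw [h'.2, h.1.env hρ, h.1.1, eval, if_neg (by simpa using h.2 ▸ hne)]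
  | sum b ih =>
    intro ρ e s he hρ hn
    refine (Runs.seq (.const (Q := fun s' => s' = s.setReg e 0) rfl) fun s' h' => Runs.seq
      (.add (Q := fun s' => Keeps e s s' ∧ s'.reg e = 0 ∧ s'.reg (e + 1) = n) ?_)
      fun s'' h => sumLoop_runs (hbody b ih ρ e s he hρ hn) h.1 h.2.1 h.2.2).mono
        (by simp [cost]) fun _ h => h
    subst h'
    refine ⟨((Keeps.refl e s).setReg le_rfl _).setReg (by omega) _, by simp, ?_⟩
    simp [Function.update_of_ne he.ne, hn]
  | sumLit c b ih =>
    intro ρ e s he hρ hn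
    refine (Runs.seq (.const (Q := fun s' => s' = s.setReg e 0) rfl) fun s' h' => Runs.seq
      (.const (Q := fun s' => Keeps e s s' ∧ s'.reg e = 0 ∧ s'.reg (e + 1) = c) ?_)
      fun s'' h => sumLoop_runs (hbody b ih ρ e s he hρ hn) h.1 h.2.1 h.2.2).mono
        (by simp [cost]) fun _ h => h
    subst h'
    exact ⟨((Keeps.refl e s).setReg le_rfl _).setReg (by omega) _, by simp, by simp⟩

/-- Run `F` for the indices `k - 1, …, 0`, in this order. -/
def iter : ℕ → (ℕ → Mem → Mem) → Mem → Mem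
  | 0, _, m => m
  | k + 1, F, m => iter k F (F k m)

/-- Statements. -/
inductive Stmt where
  | skip
  /-- assign `e` to the cell with address `a` in bank `b` -/
  | store (b : ℕ) (a e : Expr)
  | seq (p q : Stmt)
  | ite (c : Expr) (p q : Stmt)
  /-- run `p` for all indices below the input size -/
  | rep (p : Stmt)
  /-- run `p` for all indices below `c` -/
  | repLit (c : ℕ) (p : Stmt)

/-- The effect of a statement on the memory. -/
def Stmt.eval (n : ℕ) : Stmt → (ℕ → ℕ) → Mem → Mem
  | .skip, _, m => m
  | .store b a e, v, m =>
    Function.update m b (Function.update (m b) (a.eval n v m) (e.eval n v m))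
  | .seq p q, v, m => q.eval n v (p.eval n v m)
  | .ite c p q, v, m => if c.eval n v m ≠ 0 then p.eval n v m else q.eval n v m
  | .rep p, v, m => iter n (fun k => p.eval n (push k v)) m
  | .repLit c p, v, m => iter c (fun k => p.eval n (push k v)) m

/-- The loop that runs `p` with index register `e`. -/
def repLoop (p : Program) (e : ℕ) : Program :=
  .loop e (.seq (.const (e + 1) 1) (.seq (.sub e e (e + 1)) p))

/-- Code for a statement that uses no register below `e` and finds the index `i` in
register `ρ i`. -/
def Stmt.compile : Stmt → (ρ : ℕ → ℕ) → (e : ℕ) → Program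
  | .skip, _, e => .const e 0
  | .store b a x, ρ, e => .seq (a.compile ρ e) (.seq (x.compile ρ (e + 1)) (.store b e (e + 1)))
  | .seq p q, ρ, e => .seq (p.compile ρ e) (q.compile ρ e)
  | .ite c p q, ρ, e => .seq (c.compile ρ e) (.ite e (p.compile ρ e) (q.compile ρ e))
  | .rep p, ρ, e => .seq (.const e 0) (.seq (.add e 0 e)
      (repLoop (p.compile (push e ρ) (e + 1)) e))
  | .repLit c p, ρ, e => .seq (.const e c) (repLoop (p.compile (push e ρ) (e + 1)) e)

/-- A bound for the running time of a statement, as a polynomial in the input size. -/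
noncomputable def Stmt.cost : Stmt → ℕ[X]
  | .skip => 1
  | .store _ a x => a.cost + (x.cost + 1)
  | .seq p q => p.cost + q.cost
  | .ite c p q => c.cost + (1 + (p.cost + q.cost))
  | .rep p => 1 + (1 + (X * ((1 + (1 + p.cost)) + 1) + 1))
  | .repLit c p => 1 + ((c : ℕ[X]) * ((1 + (1 + p.cost)) + 1) + 1)

/-- The registers below `e` are unchanged and the memory is `m`. -/
def Leaves (e : ℕ) (m : Mem) (s s' : State) : Prop := s'.mem = m ∧ ∀ r < e, s'.reg r = s.reg r

theorem Leaves.env {e : ℕ} {m : Mem} {s s' : State} (h : Leaves e m s s') {ρ : ℕ → ℕ}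
    (hρ : ∀ i, ρ i < e) : (fun i => s'.reg (ρ i)) = fun i => s.reg (ρ i) :=
  funext fun i => h.2 _ (hρ i)

theorem repLoop_runs {p : Program} {c e k : ℕ} {F : ℕ → Mem → Mem} {m : Mem} {s₀ s : State}
    (hp : ∀ s m k, Leaves e m s₀ s → s.reg e = k →
      Runs p s c (Leaves (e + 1) (F k m) s))
    (hs : Leaves e m s₀ s) (hk : s.reg e = k) :
    Runs (repLoop p e) s (k * ((1 + (1 + c)) + 1) + 1) (Leaves e (iter k F m) s₀) := by
  refine (Runs.loop (fun j s => s.reg e = j ∧ ∃ m', Leaves e m' s₀ s ∧ iter j F m' = iter k F m)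
    (fun _ _ h => h.1) ?_ k s ⟨hk, m, hs, rfl⟩).mono le_rfl ?_
  · rintro j s ⟨hj, m', hs, hm⟩
    refine Runs.seq (.const (Q := fun s' => s' = s.setReg (e + 1) 1) rfl) ?_
    rintro _ rfl
    refine Runs.seq (.sub (Q := fun s' => Leaves e m' s₀ s' ∧ s'.reg e = j)
      ⟨⟨hs.1, fun r hr => ?_⟩, ?_⟩) ?_
    · simp [Function.update_of_ne (show r ≠ e + 1 by omega),
        Function.update_of_ne (show r ≠ e by omega), hs.2 r hr]
    · simp [hj]
    rintro s' ⟨hs', hj'⟩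
    refine (hp s' m' j hs' hj').mono le_rfl fun s'' h =>
      ⟨(h.2 e (by omega)).trans hj', F j m', ⟨h.1, fun r hr => ?_⟩, hm⟩
    exact (h.2 r (by omega)).trans (hs'.2 r hr)
  · rintro s' ⟨-, m', h, hm⟩
    rwa [← show m' = iter k F m from hm]

theorem Stmt.runs (n : ℕ) (a : Stmt) : ∀ (ρ : ℕ → ℕ) (e : ℕ) (s : State), 0 < e →
    (∀ i, ρ i < e) → s.reg 0 = n →
    Runs (a.compile ρ e) s (a.cost.eval n)
      (Leaves e (a.eval n (fun i => s.reg (ρ i)) s.mem) s) := by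
  have hbody : ∀ b : Stmt, (∀ (ρ : ℕ → ℕ) (e : ℕ) (s : State), 0 < e →
      (∀ i, ρ i < e) → s.reg 0 = n → Runs (b.compile ρ e) s (b.cost.eval n)
        (Leaves e (b.eval n (fun i => s.reg (ρ i)) s.mem) s)) →
      ∀ (ρ : ℕ → ℕ) (e : ℕ) (s₀ : State), 0 < e → (∀ i, ρ i < e) → s₀.reg 0 = n →
      ∀ s m k, Leaves e m s₀ s → s.reg e = k →
        Runs (b.compile (push e ρ) (e + 1)) s (b.cost.eval n)
          (Leaves (e + 1) (b.eval n (push k fun i => s₀.reg (ρ i)) m) s) := by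
    intro b hb ρ e s₀ he hρ hn s m k hs hk
    refine (hb (push e ρ) (e + 1) s (by omega) ?_ ((hs.2 0 he).trans hn)).mono le_rfl ?_
    · rintro (_ | i)
      · simp
      · exact (hρ i).trans (by omega)
    · rintro s' h
      have : (fun i => s.reg (push e ρ i)) = push k fun i => s₀.reg (ρ i) := by
        funext i
        cases i with
        | zero => exact hk
        | succ i => exact hs.2 _ (hρ i)
      rwa [this, hs.1] at h
  induction a with
  | skip =>
    intro ρ e s he hρ hn
    exact (Runs.const (Q := Leaves e s.mem s) ((Keeps.refl e s).setReg le_rfl _)).mono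
      (by simp [cost]) fun _ h => h
  | store b a x =>
    intro ρ e s he hρ hn
    refine (Runs.seq (a.runs n ρ e s he hρ hn) fun s' h => Runs.seq (d := 1)
      (x.runs n ρ (e + 1) s' (by omega) (fun i => (hρ i).trans (by omega))
        ((h.1.2 0 he).trans hn))
      fun s'' h' => .store ?_).mono (by simp [cost]) fun _ h => h
    refine ⟨?_, (h.1.trans h'.1 (by omega)).2⟩
    simp [eval, h'.2, h'.1.2 e (by omega), h.2, h.1.env hρ, h.1.1, h'.1.1]
  | seq p q ihp ihq =>
    intro ρ e s he hρ hn
    refine (Runs.seq (Q := Leaves e (q.eval n (fun i => s.reg (ρ i))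
      (p.eval n (fun i => s.reg (ρ i)) s.mem)) s) (ihp ρ e s he hρ hn) fun s' h =>
      (ihq ρ e s' he hρ ((h.2 0 he).trans hn)).mono le_rfl fun s'' h' =>
        ⟨?_, fun r hr => (h'.2 r hr).trans (h.2 r hr)⟩).mono (by simp [cost]) fun _ h => h
    rw [h'.1, h.env hρ, h.1]
  | ite c p q ihp ihq =>
    intro ρ e s he hρ hn
    refine (Runs.seq (c.runs n ρ e s he hρ hn)
      (d := 1 + (p.cost.eval n + q.cost.eval n)) fun s' h => Runs.ite ?_ ?_).mono
        (by simp [cost]) fun _ h => h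
    · intro hne
      refine (ihp ρ e s' he hρ ((h.1.2 0 he).trans hn)).mono (by omega) fun s'' h' =>
        ⟨?_, (h.1.trans (s'' := ⟨s''.reg, s'.mem⟩) ⟨rfl, h'.2⟩ le_rfl).2⟩
      rw [h'.1, h.1.env hρ, h.1.1, eval, if_pos (h.2 ▸ hne)]
    · intro hne
      refine (ihq ρ e s' he hρ ((h.1.2 0 he).trans hn)).mono (by omega) fun s'' h' =>
        ⟨?_, (h.1.trans (s'' := ⟨s''.reg, s'.mem⟩) ⟨rfl, h'.2⟩ le_rfl).2⟩
      rw [h'.1, h.1.env hρ, h.1.1, eval, if_neg (by simpa using h.2 ▸ hne)]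
  | rep p ih =>
    intro ρ e s he hρ hn
    refine (Runs.seq (.const (Q := fun s' => s' = s.setReg e 0) rfl) fun s' h' => Runs.seq
      (.add (Q := fun s' => Leaves e s.mem s s' ∧ s'.reg e = n) ?_)
      fun s'' h => repLoop_runs (hbody p ih ρ e s he hρ hn) h.1 h.2).mono
        (by simp [cost]) fun _ h => h
    subst h'
    refine ⟨((Keeps.refl e s).setReg le_rfl _).setReg (by omega) _, ?_⟩
    simp [Function.update_of_ne he.ne, hn]
  | repLit c p ih =>
    intro ρ e s he hρ hn
    exact (Runs.seq (.const (Q := fun s' => Leaves e s.mem s s' ∧ s'.reg e = c)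
      ⟨(Keeps.refl e s).setReg le_rfl _, by simp⟩)
      fun s'' h => repLoop_runs (hbody p ih ρ e s he hρ hn) h.1 h.2).mono
        (by simp [cost]) fun _ h => h

/-- As the indices descend, `P k` describes the memory after the indices from `k` on have been
treated. -/
theorem iter_induction {F : ℕ → Mem → Mem} (P : ℕ → Mem → Prop) {k : ℕ} {m : Mem} (h : P k m)
    (hF : ∀ j < k, ∀ m, P (j + 1) m → P j (F j m)) : P 0 (iter k F m) := by
  induction k generalizing m with
  | zero => exact h
  | succ k ih => exact ih (hF k (by omega) m h) fun j hj => hF j (by omega)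

theorem iter_const (F : Mem → Mem) (k : ℕ) (m : Mem) : iter k (fun _ => F) m = F^[k] m := by
  induction k generalizing m with
  | zero => rfl
  | succ k ih => exact ih (F m)

/-- Writing the values of `f` into bank `b`. -/
theorem iter_update (b : ℕ) (f : ℕ → Mem → ℕ) (hf : ∀ k m g, f k (Function.update m b g) = f k m)
    (k : ℕ) (m : Mem) :
    iter k (fun j m => Function.update m b (Function.update (m b) j (f j m))) m =
      Function.update m b (fun a => if a < k then f a m else m b a) := by
  induction k generalizing m with
  | zero => simp [iter]
  | succ k ih =>
    rw [iter, ih]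
    simp only [hf, Function.update_idem, Function.update_self]
    congr 1
    funext a
    rcases lt_trichotomy a k with h | rfl | h
    · simp [h, h.trans (Nat.lt_succ_self k)]
    · simp
    · simp [h.le, Function.update_of_ne h.ne', show ¬ a < k + 1 by omega]

end Lang

/-! ### Sweep cuts of the iterates of a lazy walk -/

namespace Sweep

open Finset

variable {ι : Type*} [Fintype ι] (G : SimpleGraph ι) [DecidableRel G.Adj]

/-- The number of ordered pairs of adjacent vertices in `S × T`. -/
def arcs (S T : Finset ι) : ℕ := ∑ i ∈ S, ∑ j ∈ T, if G.Adj i j then 1 else 0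

/-- Twice the Dirichlet form of the graph Laplacian. -/
def energy (x : ι → ℝ) : ℝ := ∑ i, ∑ j, if G.Adj i j then (x i - x j) ^ 2 else 0

/-- The graph Laplacian. -/
def lap (x : ι → ℝ) (i : ι) : ℝ := ∑ j, if G.Adj i j then x i - x j else 0

/-- The operator `2 D - L`, where `L` is the Laplacian. -/
def lazyStep (D : ℕ) : (ι → ℝ) →ₗ[ℝ] (ι → ℝ) where
  toFun x i := 2 * D * x i - lap G x i
  map_add' x y := by
    funext i
    simp only [lap, Pi.add_apply]
    rw [show (∑ j, if G.Adj i j then x i + y i - (x j + y j) else 0) =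
      (∑ j, if G.Adj i j then x i - x j else 0) + ∑ j, if G.Adj i j then y i - y j else 0 by
        rw [← sum_add_distrib]; exact sum_congr rfl fun j _ => by split_ifs <;> ring]
    ring
  map_smul' c x := by
    funext i
    simp only [lap, Pi.smul_apply, smul_eq_mul, RingHom.id_apply]
    rw [show (∑ j, if G.Adj i j then c * x i - c * x j else 0) =
      c * ∑ j, if G.Adj i j then x i - x j else 0 by
        rw [mul_sum]; exact sum_congr rfl fun j _ => by split_ifs <;> ring]
    ring

/-- The operator `lazyStep` on vectors of natural numbers. -/
def natStep (D : ℕ) (x : ι → ℕ) (i : ι) : ℕ :=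
  2 * D * x i + (∑ j, if G.Adj i j then x j else 0) - ∑ j, if G.Adj i j then x i else 0

theorem lazyStep_apply (D : ℕ) (x : ι → ℝ) (i : ι) :
    lazyStep G D x i = 2 * D * x i - lap G x i := rfl

variable {G}

theorem sum_adj_swap {M : Type*} [AddCommMonoid M] (F : ι → ι → M) :
    (∑ i, ∑ j, if G.Adj i j then F i j else 0) = ∑ i, ∑ j, if G.Adj i j then F j i else 0 := by
  rw [sum_comm]
  exact sum_congr rfl fun i _ => sum_congr rfl fun j _ => by simp only [G.adj_comm]

theorem sum_adj_const (i : ι) (c : ℝ) : (∑ j, if G.Adj i j then c else 0) = G.degree i * c := by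
  rw [← sum_filter, sum_const, nsmul_eq_mul, ← SimpleGraph.card_neighborFinset_eq_degree,
    SimpleGraph.neighborFinset_eq_filter]

/-- The subtraction never truncates, because the subtracted term is `deg i * x i ≤ 2 D * x i`. Hence
the machine follows the real operator without rounding. -/
theorem natStep_cast {D : ℕ} (hdeg : ∀ i, G.degree i ≤ D) (x : ι → ℕ) :
    (fun i => (natStep G D x i : ℝ)) = lazyStep G D fun i => (x i : ℝ) := by
  funext i
  have h1 : (∑ j, if G.Adj i j then x i else 0) = G.degree i * x i := by
    exact_mod_cast sum_adj_const (G := G) i (x i : ℝ)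
  have h2 : (∑ j, if G.Adj i j then x i else 0) ≤ 2 * D * x i := by
    rw [h1]; exact Nat.mul_le_mul_right _ ((hdeg i).trans (by omega))
  rw [natStep, Nat.cast_sub (h2.trans (Nat.le_add_right _ _)), lazyStep_apply, lap]
  push_cast
  rw [add_sub_assoc, ← sum_sub_distrib, ← sub_neg_eq_add, ← sum_neg_distrib]
  congr 1
  exact sum_congr rfl fun j _ => by split_ifs <;> ring

/-- Average the sum over ordered adjacent pairs with its copy in which the two ends are swapped. -/
theorem sum_mul_lap (x y : ι → ℝ) : ∑ i, y i * lap G x i =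
    (∑ i, ∑ j, if G.Adj i j then (x i - x j) * (y i - y j) else 0) / 2 := by
  have h : ∑ i, y i * lap G x i = ∑ i, ∑ j, if G.Adj i j then y i * (x i - x j) else 0 :=
    sum_congr rfl fun i _ => by
      rw [lap, mul_sum]; exact sum_congr rfl fun j _ => by split_ifs <;> simp
  have h' : ∑ i, y i * lap G x i = ∑ i, ∑ j, if G.Adj i j then y j * (x j - x i) else 0 :=
    h.trans (sum_adj_swap _)
  have : ∑ i, y i * lap G x i + ∑ i, y i * lap G x i =
      ∑ i, ∑ j, if G.Adj i j then (x i - x j) * (y i - y j) else 0 := by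
    nth_rewrite 1 [h]
    rw [h', ← sum_add_distrib]
    refine sum_congr rfl fun i _ => ?_
    rw [← sum_add_distrib]
    exact sum_congr rfl fun j _ => by split_ifs <;> ring
  linarith

theorem sum_mul_lap_self (x : ι → ℝ) : ∑ i, x i * lap G x i = energy G x / 2 := by
  rw [sum_mul_lap, energy]; simp only [sq]

theorem sum_mul_lap_comm (x y : ι → ℝ) : ∑ i, y i * lap G x i = ∑ i, x i * lap G y i := by
  rw [sum_mul_lap, sum_mul_lap]; simp only [mul_comm]

theorem sum_mul_lazyStep (D : ℕ) (x y : ι → ℝ) :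
    ∑ i, y i * lazyStep G D x i = ∑ i, x i * lazyStep G D y i := by
  simp only [lazyStep_apply, mul_sub, sum_sub_distrib, sum_mul_lap_comm x y]
  congr 1
  exact sum_congr rfl fun i _ => by ring

theorem sum_mul_lazyStep_self (D : ℕ) (x : ι → ℝ) :
    ∑ i, x i * lazyStep G D x i = 2 * D * ∑ i, x i ^ 2 - energy G x / 2 := by
  simp only [lazyStep_apply, mul_sub, sum_sub_distrib, sum_mul_lap_self, mul_sum]
  congr 1
  exact sum_congr rfl fun i _ => by ring

theorem sum_lap (x : ι → ℝ) : ∑ i, lap G x i = 0 := by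
  simpa using sum_mul_lap (G := G) x 1

/-- Cauchy–Schwarz at each vertex, over its at most `D` neighbours. -/
theorem sum_lap_sq_le {D : ℕ} (hdeg : ∀ i, G.degree i ≤ D) (x : ι → ℝ) :
    ∑ i, lap G x i ^ 2 ≤ D * energy G x := by
  rw [energy, mul_sum]
  refine sum_le_sum fun i _ => ?_
  have h := sum_mul_sq_le_sq_mul_sq univ (fun j => if G.Adj i j then (1 : ℝ) else 0)
    fun j => if G.Adj i j then x i - x j else 0
  have e1 : (∑ j, (if G.Adj i j then (1 : ℝ) else 0) ^ 2) = G.degree i := by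
    rw [← mul_one (G.degree i : ℝ), ← sum_adj_const]
    exact sum_congr rfl fun j _ => by split_ifs <;> simp
  have e2 : (∑ j, (if G.Adj i j then x i - x j else 0) ^ 2) =
      ∑ j, if G.Adj i j then (x i - x j) ^ 2 else 0 :=
    sum_congr rfl fun j _ => by split_ifs <;> simp
  have e3 : (∑ j, (if G.Adj i j then (1 : ℝ) else 0) * if G.Adj i j then x i - x j else 0) =
      lap G x i := sum_congr rfl fun j _ => by split_ifs <;> simp
  rw [e1, e2, e3] at h
  refine h.trans (mul_le_mul_of_nonneg_right (by exact_mod_cast hdeg i)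
    (sum_nonneg fun j _ => by split_ifs <;> positivity))

/-- The cross term contributes `-2 D` times the energy, and `sum_lap_sq_le` gives back at most half
of that. This is what the shift by `2 D` is for. -/
theorem sum_lazyStep_sq_le {D : ℕ} (hdeg : ∀ i, G.degree i ≤ D) (x : ι → ℝ) :
    ∑ i, lazyStep G D x i ^ 2 ≤ 4 * D ^ 2 * ∑ i, x i ^ 2 - D * energy G x := by
  have h : ∑ i, lazyStep G D x i ^ 2 =
      4 * D ^ 2 * ∑ i, x i ^ 2 - 4 * D * ∑ i, x i * lap G x i + ∑ i, lap G x i ^ 2 := by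
    rw [mul_sum, mul_sum, ← sum_sub_distrib, ← sum_add_distrib]
    exact sum_congr rfl fun i _ => by rw [lazyStep_apply]; ring
  rw [h, sum_mul_lap_self]
  have := sum_lap_sq_le hdeg x
  linarith

theorem sum_lazyStep (D : ℕ) (x : ι → ℝ) : ∑ i, lazyStep G D x i = 2 * D * ∑ i, x i := by
  simp only [lazyStep_apply, sum_sub_distrib, sum_lap, mul_sum, sub_zero]

theorem lazyStep_const (D : ℕ) (c : ℝ) : lazyStep G D (fun _ => c) = fun _ => 2 * D * c := by
  funext i; simp [lazyStep_apply, lap]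

/-! ### Coarea and Cheeger inequalities for level sets. -/

/-- A coarea inequality. -/
theorem sum_le_mul_sum_tsub {q : ℕ} (g : ι → ℕ)
    (h : ∀ s, #{i | s < g i} ≤ q * arcs G {i | s < g i} {i | ¬ s < g i}) :
    ∑ i, g i ≤ q * ∑ i, ∑ j, if G.Adj i j then g i - g j else 0 := by
  have hB : ∀ i, g i ≤ ∑ i, g i := fun i => single_le_sum (fun _ _ => Nat.zero_le _) (mem_univ i)
  set B := ∑ i, g i with hBdef
  -- Layer-cake summation; the total `B` serves as a common bound for all values of `g`.
  have h1 : ∑ i, g i = ∑ s ∈ range B, #{i | s < g i} := by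
    simp only [card_filter]
    rw [sum_comm]
    refine sum_congr rfl fun i _ => ?_
    rw [← card_filter, show (range B).filter (fun s => s < g i) = range (g i) by
      ext s; have := hB i; simp only [mem_filter, mem_range]; omega, card_range]
  have h2 : ∑ s ∈ range B, arcs G {i | s < g i} {i | ¬ s < g i} =
      ∑ i, ∑ j, if G.Adj i j then g i - g j else 0 := by
    have : ∀ s, arcs G {i | s < g i} {i | ¬ s < g i} =
        ∑ i, ∑ j, if G.Adj i j then (if g j ≤ s ∧ s < g i then 1 else 0) else 0 := by
      intro s
      rw [arcs, sum_filter]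
      refine sum_congr rfl fun i _ => ?_
      rw [sum_filter]
      split_ifs with hi
      · exact sum_congr rfl fun j _ => by simp only [not_lt, hi, and_true]; split_ifs <;> rfl
      · simp [hi]
    simp only [this]
    rw [sum_comm]
    refine sum_congr rfl fun i _ => ?_
    rw [sum_comm]
    refine sum_congr rfl fun j _ => ?_
    split_ifs
    · rw [← card_filter, show (range B).filter (fun s => g j ≤ s ∧ s < g i) = Ico (g j) (g i) by
        ext s; have := hB i; simp only [mem_filter, mem_range, mem_Ico]; omega, Nat.card_Ico]
    · simp
  rw [hBdef, h1, ← h2, mul_sum]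
  exact sum_le_sum fun s _ => h s

/-- A Cheeger inequality for a vector all of whose superlevel sets expand. -/
theorem sum_sq_le_energy {q D : ℕ} (hq : 0 < q) (hD : 0 < D) (hdeg : ∀ i, G.degree i ≤ D)
    (z : ι → ℕ) (h : ∀ s, #{i | s < z i} ≤ q * arcs G {i | s < z i} {i | ¬ s < z i}) :
    ∑ i, (z i : ℝ) ^ 2 ≤ q ^ 2 * D * energy G fun i => (z i : ℝ) := by
  -- Coarea for the squares: `s < z i ^ 2` means `Nat.sqrt s < z i`, so the level sets are those of
  -- `z`.
  have h1 : ∑ i, z i ^ 2 ≤ q * ∑ i, ∑ j, if G.Adj i j then z i ^ 2 - z j ^ 2 else 0 := by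
    refine sum_le_mul_sum_tsub _ fun s => ?_
    simp only [← Nat.sqrt_lt']
    exact h _
  have h2 : ∑ i, (z i : ℝ) ^ 2 ≤
      q * ∑ i, ∑ j, if G.Adj i j then ((z i ^ 2 - z j ^ 2 : ℕ) : ℝ) else 0 := by
    exact_mod_cast h1
  set A : ℝ := ∑ i, ∑ j, if G.Adj i j then ((z i ^ 2 - z j ^ 2 : ℕ) : ℝ) else 0 with hA
  set N : ℝ := ∑ i, (z i : ℝ) ^ 2 with hN
  set E := energy G fun i => (z i : ℝ) with hE
  have hq' : (0 : ℝ) < q := by exact_mod_cast hq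
  have hD' : (0 : ℝ) < D := by exact_mod_cast hD
  have hdegsum : (∑ i, ∑ j, if G.Adj i j then (z i : ℝ) ^ 2 else 0) ≤ D * N := by
    rw [hN, mul_sum]
    refine sum_le_sum fun i _ => ?_
    rw [sum_adj_const]
    exact mul_le_mul_of_nonneg_right (by exact_mod_cast hdeg i) (sq_nonneg _)
  -- Adding the swapped copy of `A` turns the truncated differences into `|z i ^ 2 - z j ^ 2|` over
  -- all arcs.
  have h3 : A + A ≤ q * D * E + (1 / (q * D)) *
      ((∑ i, ∑ j, if G.Adj i j then (z i : ℝ) ^ 2 else 0) / 2 +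
        (∑ i, ∑ j, if G.Adj i j then (z j : ℝ) ^ 2 else 0) / 2) := by
    have hA' : A = ∑ i, ∑ j, if G.Adj i j then ((z j ^ 2 - z i ^ 2 : ℕ) : ℝ) else 0 :=
      sum_adj_swap (fun i j => ((z i ^ 2 - z j ^ 2 : ℕ) : ℝ))
    nth_rewrite 2 [hA']
    rw [hA, hE, energy, ← sum_add_distrib, mul_sum, ← add_div, ← sum_add_distrib, sum_div, mul_sum,
      ← sum_add_distrib]
    refine sum_le_sum fun i _ => ?_
    rw [← sum_add_distrib, mul_sum, ← sum_add_distrib, sum_div, mul_sum, ← sum_add_distrib]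
    refine sum_le_sum fun j _ => ?_
    split_ifs
    swap
    · simp
    -- The weight `q * D` is chosen so that, after multiplication by `q`, the second term sums to at
    -- most one copy of `N`. It is absorbed at the end, since `2 N ≤ 2 q A`.
    have key : ∀ a b : ℝ, a ^ 2 - b ^ 2 ≤
        q * D * (a - b) ^ 2 + 1 / (q * D) * ((a ^ 2 + b ^ 2) / 2) := by
      intro a b
      have : q * D * (a - b) ^ 2 + 1 / (q * D) * ((a ^ 2 + b ^ 2) / 2) - (a ^ 2 - b ^ 2) =
        (q * D * (a - b) - (a + b) / 2) ^ 2 / (q * D) + (a - b) ^ 2 / (4 * (q * D)) := by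
          field_simp; ring
      have : 0 ≤ (q * D * (a - b) - (a + b) / 2) ^ 2 / (q * D) + (a - b) ^ 2 / (4 * (q * D)) := by
        positivity
      linarith
    rcases le_total (z i) (z j) with hij | hij
    · have hij' : z i ^ 2 ≤ z j ^ 2 := Nat.pow_le_pow_left hij 2
      rw [Nat.sub_eq_zero_of_le hij', Nat.cast_sub hij']
      have := key (z j) (z i)
      push_cast
      linarith [sub_sq_comm (z i : ℝ) (z j), add_comm ((z i : ℝ) ^ 2) ((z j : ℝ) ^ 2)]
    · have hij' : z j ^ 2 ≤ z i ^ 2 := Nat.pow_le_pow_left hij 2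
      rw [Nat.sub_eq_zero_of_le hij', Nat.cast_sub hij']
      have := key (z i) (z j)
      push_cast
      linarith
  have h4 := sum_adj_swap (G := G) fun i _ => (z i : ℝ) ^ 2
  rw [← h4, add_halves] at h3
  have h5 : (1 / (q * D : ℝ)) * (∑ i, ∑ j, if G.Adj i j then (z i : ℝ) ^ 2 else 0) ≤ N / q := by
    rw [div_mul_eq_mul_div, one_mul, div_le_div_iff₀ (by positivity) hq']
    nlinarith
  have h6 : q * A * 2 ≤ q ^ 2 * D * E + N := by
    calc q * A * 2 = q * (A + A) := by ring
      _ ≤ q * (q * D * E + N / q) := mul_le_mul_of_nonneg_left (by linarith) hq'.le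
      _ = _ := by field_simp
  linarith

/-- Both kinds of level sets of `x` with at most half of the vertices expand. -/
def LevelsExpand (G : SimpleGraph ι) [DecidableRel G.Adj] (q : ℕ) (x : ι → ℕ) : Prop :=
  ∀ u, (2 * #{i | x u ≤ x i} ≤ Fintype.card ι →
      #{i | x u ≤ x i} ≤ q * arcs G {i | x u ≤ x i} {i | ¬ x u ≤ x i}) ∧
    (2 * #{i | x i ≤ x u} ≤ Fintype.card ι →
      #{i | x i ≤ x u} ≤ q * arcs G {i | x i ≤ x u} {i | ¬ x i ≤ x u})

/-- Take the least `m` with at most half of the values above it. By minimality more than half of the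
values exceed `m - 1`, that is, are at least `m`. -/
theorem exists_median (x : ι → ℕ) :
    ∃ m, 2 * #{i | m < x i} ≤ Fintype.card ι ∧ 2 * #{i | x i < m} ≤ Fintype.card ι := by
  have hex : ∃ m, 2 * #{i | m < x i} ≤ Fintype.card ι := by
    refine ⟨∑ i, x i, ?_⟩
    rw [filter_false_of_mem fun i _ => not_lt.2
      (single_le_sum (fun _ _ => Nat.zero_le _) (mem_univ i))]
    simp
  classical
  refine ⟨Nat.find hex, Nat.find_spec hex, ?_⟩
  rcases h : Nat.find hex with _ | m
  · simp
  · have hm := Nat.find_min hex (m := m) (by omega)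
    have := card_filter_add_card_filter_not (s := (univ : Finset ι)) fun i => m < x i
    simp only [not_lt, ← Nat.lt_succ_iff, card_univ] at this
    simp only [Nat.succ_eq_add_one] at this
    omega

/-- Cut `x` at a median: the parts above and below it have level sets with at most half of the
vertices, so the Cheeger inequality applies to both. Their energies add up to at most that of `x`.
-/
theorem sum_sub_sq_le_energy {q D : ℕ} (hq : 0 < q) (hD : 0 < D) (hdeg : ∀ i, G.degree i ≤ D)
    {x : ι → ℕ} (h : LevelsExpand G q x) :
    ∃ m : ℝ, ∑ i, ((x i : ℝ) - m) ^ 2 ≤ q ^ 2 * D * energy G fun i => (x i : ℝ) := by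
  obtain ⟨m, hm, hm'⟩ := exists_median x
  refine ⟨m, ?_⟩
  have hup := sum_sq_le_energy hq hD hdeg (fun i => x i - m) fun s => by
    rcases (univ.filter fun i => s < x i - m).eq_empty_or_nonempty with he | hne
    · simp [he]
    -- A nonempty level set is cut off at a value attained at one of its vertices, so one test per
    -- vertex covers all thresholds.
    obtain ⟨u, hu, hmin⟩ := exists_min_image _ x hne
    simp only [mem_filter, mem_univ, true_and] at hu hmin
    have hiff : ∀ i, s < x i - m ↔ x u ≤ x i := fun i => ⟨hmin i, fun hi => by omega⟩
    simp only [hiff]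
    refine (h u).1 (le_trans ?_ hm)
    gcongr 2 * #?_
    exact monotone_filter_right _ fun i _ hi => by omega
  have hlow := sum_sq_le_energy hq hD hdeg (fun i => m - x i) fun s => by
    rcases (univ.filter fun i => s < m - x i).eq_empty_or_nonempty with he | hne
    · simp [he]
    obtain ⟨u, hu, hmax⟩ := exists_max_image _ x hne
    simp only [mem_filter, mem_univ, true_and] at hu hmax
    have hiff : ∀ i, s < m - x i ↔ x i ≤ x u := fun i => ⟨hmax i, fun hi => by omega⟩
    simp only [hiff]
    refine (h u).2 (le_trans ?_ hm')
    gcongr 2 * #?_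
    exact monotone_filter_right _ fun i _ hi => by omega
  have hsum : ∑ i, ((x i : ℝ) - m) ^ 2 =
      ∑ i, ((x i - m : ℕ) : ℝ) ^ 2 + ∑ i, ((m - x i : ℕ) : ℝ) ^ 2 := by
    rw [← sum_add_distrib]
    refine sum_congr rfl fun i _ => ?_
    rcases le_total (x i) m with hi | hi <;> rw [Nat.cast_sub hi, Nat.sub_eq_zero_of_le hi] <;>
      push_cast <;> ring
  -- For an arc that straddles the median, this is `a ^ 2 + b ^ 2 ≤ (a + b) ^ 2` with `a`, `b`
  -- nonnegative.
  have henergy : (energy G fun i => ((x i - m : ℕ) : ℝ)) + (energy G fun i => ((m - x i : ℕ) : ℝ)) ≤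
      energy G fun i => (x i : ℝ) := by
    simp only [energy]
    rw [← sum_add_distrib]
    refine sum_le_sum fun i _ => ?_
    rw [← sum_add_distrib]
    refine sum_le_sum fun j _ => ?_
    split_ifs
    swap
    · simp
    rcases le_total (x i) m with hi | hi <;> rcases le_total (x j) m with hj | hj <;>
      rw [Nat.cast_sub hi, Nat.sub_eq_zero_of_le hi, Nat.cast_sub hj, Nat.sub_eq_zero_of_le hj] <;>
      push_cast
    · linarith [sq_nonneg ((x i : ℝ) - x j)]
    · nlinarith [mul_nonneg (sub_nonneg.2 (Nat.cast_le (α := ℝ).2 hi))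
        (sub_nonneg.2 (Nat.cast_le (α := ℝ).2 hj))]
    · nlinarith [mul_nonneg (sub_nonneg.2 (Nat.cast_le (α := ℝ).2 hi))
        (sub_nonneg.2 (Nat.cast_le (α := ℝ).2 hj))]
    · linarith [sq_nonneg ((x i : ℝ) - x j)]
  rw [hsum]
  refine (add_le_add hup hlow).trans ?_
  rw [← mul_add]
  exact mul_le_mul_of_nonneg_left henergy (by positivity)

end Sweep

/-! ### Contraction of the iterates against the growth forced by a sparse set. -/

namespace Sweep

open Finset

variable {ι : Type*} [Fintype ι] {G : SimpleGraph ι} [DecidableRel G.Adj]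

theorem iterate_natStep_cast {D : ℕ} (hdeg : ∀ i, G.degree i ≤ D) (x : ι → ℕ) (t : ℕ) :
    (fun i => (((natStep G D)^[t] x) i : ℝ)) = (lazyStep G D ^ t) fun i => (x i : ℝ) := by
  induction t with
  | zero => rfl
  | succ t ih => rw [Function.iterate_succ_apply', natStep_cast hdeg, ih, pow_succ']; rfl

theorem energy_sub_const (x : ι → ℝ) (c : ℝ) : energy G (fun i => x i - c) = energy G x := by
  simp only [energy, sub_sub_sub_cancel_right]

theorem sum_pow_lazyStep (D : ℕ) (x : ι → ℝ) (t : ℕ) :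
    ∑ i, (lazyStep G D ^ t) x i = (2 * D) ^ t * ∑ i, x i := by
  induction t with
  | zero => simp
  | succ t ih =>
    rw [pow_succ', Module.End.mul_apply, sum_lazyStep, ih]; ring

theorem pow_lazyStep_const (D : ℕ) (c : ℝ) (t : ℕ) :
    (lazyStep G D ^ t) (fun _ => c) = fun _ => (2 * D) ^ t * c := by
  induction t with
  | zero => simp
  | succ t ih => rw [pow_succ', Module.End.mul_apply, ih, lazyStep_const]; funext; ring

/-- If the level sets of the iterates of a vector expand, then these iterates converge to
a constant vector. -/
theorem sum_sq_pow_lazyStep_le {q D : ℕ} (hq : 0 < q) (hD : 0 < D) (hdeg : ∀ i, G.degree i ≤ D)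
    (x : ι → ℕ) (c : ℝ) (hc : ∑ i, ((x i : ℝ) - c) = 0) (T : ℕ)
    (h : ∀ t < T, LevelsExpand G q ((natStep G D)^[t] x)) :
    ∑ i, (lazyStep G D ^ T) (fun i => (x i : ℝ) - c) i ^ 2 ≤
      (4 * D ^ 2 - 1 / q ^ 2) ^ T * ∑ i, ((x i : ℝ) - c) ^ 2 := by
  have hq' : (1 : ℝ) ≤ q := by exact_mod_cast hq
  have hD' : (1 : ℝ) ≤ D := by exact_mod_cast hD
  have hK : (0 : ℝ) ≤ 4 * D ^ 2 - 1 / q ^ 2 := by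
    have : 1 / (q : ℝ) ^ 2 ≤ 1 := by rw [div_le_one (by positivity)]; nlinarith
    nlinarith
  induction T with
  | zero => simp
  | succ T ih =>
    have ih' := ih fun t ht => h t (by omega)
    set y := (lazyStep G D ^ T) fun i => (x i : ℝ) - c with hy
    set X := (natStep G D)^[T] x with hX
    have hyX : y = fun i => (X i : ℝ) - (2 * D) ^ T * c := by
      have h1 := iterate_natStep_cast hdeg x T
      have h2 : (fun i => (x i : ℝ) - c) = (fun i => (x i : ℝ)) - fun _ => c := rfl
      rw [hy, h2, map_sub, ← h1, pow_lazyStep_const]; rfl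
    have hy0 : ∑ i, y i = 0 := by rw [hy, sum_pow_lazyStep, hc, mul_zero]
    obtain ⟨m, hm⟩ := sum_sub_sq_le_energy hq hD hdeg (h T (by omega))
    -- As `y` has sum zero, it is `X` minus its mean, and the mean minimises the squared distance to
    -- constants. So the median may replace it.
    have hvar : ∑ i, y i ^ 2 ≤ ∑ i, ((X i : ℝ) - m) ^ 2 := by
      set d := (2 * D) ^ T * c - m with hd
      have : ∑ i, ((X i : ℝ) - m) ^ 2 =
          ∑ i, y i ^ 2 + 2 * d * ∑ i, y i + ∑ _i : ι, d ^ 2 := by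
        rw [mul_sum, ← sum_add_distrib, ← sum_add_distrib]
        exact sum_congr rfl fun i _ => by rw [hyX, hd]; ring
      rw [this, hy0]
      have : 0 ≤ ∑ _i : ι, d ^ 2 := sum_nonneg fun _ _ => sq_nonneg _
      linarith
    have hE : energy G y = energy G fun i => (X i : ℝ) := by rw [hyX, energy_sub_const]
    have hstep := sum_lazyStep_sq_le hdeg y
    have hle : ∑ i, y i ^ 2 ≤ q ^ 2 * D * energy G y := by rw [hE]; exact hvar.trans hm
    have hle' : 1 / (q : ℝ) ^ 2 * ∑ i, y i ^ 2 ≤ D * energy G y := by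
      rw [div_mul_eq_mul_div, one_mul, div_le_iff₀ (by positivity)]; linarith
    rw [pow_succ' (lazyStep G D), Module.End.mul_apply]
    calc _ ≤ (4 * D ^ 2 - 1 / q ^ 2) * ∑ i, y i ^ 2 := by linarith
      _ ≤ (4 * D ^ 2 - 1 / q ^ 2) *
          ((4 * D ^ 2 - 1 / q ^ 2) ^ T * ∑ i, ((x i : ℝ) - c) ^ 2) :=
        mul_le_mul_of_nonneg_left ih' hK
      _ = _ := by ring

/-- The norms of the iterates of a self-adjoint operator grow at least geometrically. -/
theorem pow_mul_sum_sq_le (D : ℕ) (f : ι → ℝ) {r : ℝ} (hr : 0 < r) (hf : 0 < ∑ i, f i ^ 2)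
    (h1 : r * ∑ i, f i ^ 2 ≤ ∑ i, lazyStep G D f i ^ 2) (T : ℕ) :
    r ^ T * ∑ i, f i ^ 2 ≤ ∑ i, (lazyStep G D ^ T) f i ^ 2 := by
  set b : ℕ → ℝ := fun t => ∑ i, (lazyStep G D ^ t) f i ^ 2 with hb
  -- Self-adjointness makes `b (t + 1)` the inner product of the iterates `t` and `t + 2`.
  -- Cauchy–Schwarz then gives log-convexity, so the first growth ratio persists.
  have hconv : ∀ t, b (t + 1) ^ 2 ≤ b t * b (t + 2) := by
    intro t
    set y := (lazyStep G D ^ t) f with hy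
    have e1 : (lazyStep G D ^ (t + 1)) f = lazyStep G D y := by
      rw [pow_succ', Module.End.mul_apply]
    have e2 : (lazyStep G D ^ (t + 2)) f = lazyStep G D (lazyStep G D y) := by
      rw [pow_succ', Module.End.mul_apply, e1]
    have : b (t + 1) = ∑ i, y i * lazyStep G D (lazyStep G D y) i := by
      rw [sum_mul_lazyStep, hb]; simp only [e1, sq]
    rw [this]
    simp only [hb, e2]
    exact sum_mul_sq_le_sq_mul_sq _ _ _
  have key : ∀ t, 0 < b t ∧ r * b t ≤ b (t + 1) := by
    intro t
    induction t with
    | zero => simpa [hb] using ⟨hf, h1⟩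
    | succ t ih =>
      have hpos : 0 < b (t + 1) := lt_of_lt_of_le (mul_pos hr ih.1) ih.2
      refine ⟨hpos, le_of_mul_le_mul_left ?_ ih.1⟩
      calc b t * (r * b (t + 1)) = r * b t * b (t + 1) := by ring
        _ ≤ b (t + 1) * b (t + 1) := mul_le_mul_of_nonneg_right ih.2 hpos.le
        _ ≤ _ := by rw [← sq]; exact hconv t
  induction T with
  | zero => simp
  | succ T ih =>
    calc r ^ (T + 1) * ∑ i, f i ^ 2 = r * (r ^ T * ∑ i, f i ^ 2) := by ring
      _ ≤ r * b T := mul_le_mul_of_nonneg_left ih hr.le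
      _ ≤ _ := (key T).2

variable [DecidableEq ι]

/-- A vector with sum zero is the combination of the shifted unit vectors with its own entries as
coefficients, as the shifts cancel. Cauchy–Schwarz over the starting points costs the factor
`Fintype.card ι`. -/
theorem sum_sq_pow_lazyStep_le_of_sum_eq_zero {D : ℕ} (f : ι → ℝ) (hf : ∑ i, f i = 0) (T : ℕ)
    {B c : ℝ} (h : ∀ i, ∑ v, (lazyStep G D ^ T)
      (fun v => (((Pi.single i 1 : ι → ℕ) v : ℕ) : ℝ) - c) v ^ 2 ≤ B) :
    ∑ v, (lazyStep G D ^ T) f v ^ 2 ≤ (∑ i, f i ^ 2) * (Fintype.card ι * B) := by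
  set y : ι → ι → ℝ := fun i => (lazyStep G D ^ T)
    (fun v => (((Pi.single i 1 : ι → ℕ) v : ℕ) : ℝ) - c) with hy
  have hdecomp : f = ∑ i, f i • fun v => (((Pi.single i 1 : ι → ℕ) v : ℕ) : ℝ) - c := by
    funext v
    simp only [Finset.sum_apply, Pi.smul_apply, smul_eq_mul, mul_sub, sum_sub_distrib, ← sum_mul, hf,
      Pi.single_apply]
    simp
  have hM : ∀ v, (lazyStep G D ^ T) f v = ∑ i, f i * y i v := by
    intro v
    conv_lhs => rw [hdecomp]
    simp [map_sum, hy]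
  calc ∑ v, (lazyStep G D ^ T) f v ^ 2 ≤ ∑ v, (∑ i, f i ^ 2) * ∑ i, y i v ^ 2 := by
        refine sum_le_sum fun v _ => ?_
        rw [hM]
        exact sum_mul_sq_le_sq_mul_sq _ _ _
    _ = (∑ i, f i ^ 2) * ∑ i, ∑ v, y i v ^ 2 := by rw [← mul_sum, sum_comm]
    _ ≤ _ := by
        refine mul_le_mul_of_nonneg_left ?_ (sum_nonneg fun _ _ => sq_nonneg _)
        calc ∑ i, ∑ v, y i v ^ 2 ≤ ∑ _i : ι, B := sum_le_sum fun i _ => h i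
          _ = _ := by simp

theorem energy_indicator (S : Finset ι) :
    energy G (fun i => if i ∈ S then 1 else 0) = 2 * arcs G S Sᶜ := by
  have h : (arcs G S Sᶜ : ℝ) =
      ∑ i, ∑ j, if G.Adj i j then (if i ∈ S ∧ j ∉ S then (1 : ℝ) else 0) else 0 := by
    rw [arcs]
    push_cast
    rw [← sum_subset (subset_univ S)
      fun i _ hi => sum_eq_zero fun j _ => by simp [hi]]
    refine sum_congr rfl fun i hi => ?_
    rw [← sum_subset (subset_univ Sᶜ) fun j _ hj => by simp [show j ∈ S by simpa using hj]]
    exact sum_congr rfl fun j hj => by simp [hi, show j ∉ S by simpa using hj]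
  have h' := h.trans (sum_adj_swap _)
  rw [two_mul]
  nth_rewrite 1 [h]
  rw [h', energy, ← sum_add_distrib]
  refine sum_congr rfl fun i _ => ?_
  rw [← sum_add_distrib]
  refine sum_congr rfl fun j _ => ?_
  by_cases hi : i ∈ S <;> by_cases hj : j ∈ S <;> simp [hi, hj]

/-- If the level sets of the iterates of the lazy walk expand, for all starting points, then
the graph is an edge expander. -/
theorem card_le_arcs_of_levelsExpand {q D n : ℕ} (hq : 0 < q) (hD : 0 < D)
    (hdeg : ∀ i, G.degree i ≤ D) (hn : Fintype.card ι ≤ n)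
    (h : ∀ i, ∀ t < 8 * D ^ 2 * q ^ 2 * n,
      LevelsExpand G q ((natStep G D)^[t] (Pi.single i 1)))
    (S : Finset ι) (hS : 2 * #S ≤ Fintype.card ι) : #S ≤ 16 * D * q ^ 2 * arcs G S Sᶜ := by
  by_contra! hlt
  have hSpos : 0 < #S := by omega
  have hcard : 0 < Fintype.card ι := by omega
  have hq' : (1 : ℝ) ≤ q := by exact_mod_cast hq
  have hD' : (1 : ℝ) ≤ D := by exact_mod_cast hD
  have hc' : (0 : ℝ) < Fintype.card ι := by exact_mod_cast hcard
  have hS' : (0 : ℝ) < #S := by exact_mod_cast hSpos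
  set N : ℝ := (Fintype.card ι : ℝ) with hN
  set T := 8 * D ^ 2 * q ^ 2 * n with hT
  set K : ℝ := 4 * D ^ 2 - 1 / q ^ 2 with hK
  set r : ℝ := 4 * D ^ 2 - 1 / (2 * q ^ 2) with hr
  have hq1 : 1 / (q : ℝ) ^ 2 ≤ 1 := by rw [div_le_one (by positivity)]; nlinarith
  have hq2 : 1 / (2 * (q : ℝ) ^ 2) = 1 / (q : ℝ) ^ 2 / 2 := by field_simp
  have hqpos : 0 < 1 / (q : ℝ) ^ 2 := by positivity
  have hKpos : 0 < K := by nlinarith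
  have hrpos : 0 < r := by nlinarith
  set f : ι → ℝ := fun i => (if i ∈ S then 1 else 0) - #S / N with hf
  have hfsum : ∑ i, f i = 0 := by
    simp only [hf, sum_sub_distrib, sum_const, card_univ, nsmul_eq_mul, ← hN]
    simp; field_simp; simp
  have hfsq : ∑ i, f i ^ 2 = #S - (#S : ℝ) ^ 2 / N := by
    have : ∀ i, f i ^ 2 = (if i ∈ S then 1 else 0) * (1 - 2 * (#S / N)) + (#S / N) ^ 2 := by
      intro i; simp only [hf]; split_ifs <;> ring
    simp only [this, sum_add_distrib, ← sum_mul, sum_const, card_univ, nsmul_eq_mul, ← hN]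
    simp; field_simp; ring
  have hhalf : (#S : ℝ) / 2 ≤ ∑ i, f i ^ 2 := by
    have : (2 : ℝ) * #S ≤ N := by rw [hN]; exact_mod_cast hS
    rw [hfsq]
    have : (#S : ℝ) ^ 2 / N ≤ #S / 2 := by
      rw [div_le_div_iff₀ hc' two_pos]; nlinarith
    linarith
  have hfpos : 0 < ∑ i, f i ^ 2 := by linarith
  -- Half the energy of `f` is the number of arcs leaving `S`. This is below `#S / (16 D q²)`, and
  -- `#S` is at most `2 ∑ f²`.
  have hinner : (2 * D - 1 / (8 * D * q ^ 2)) * ∑ i, f i ^ 2 ≤ ∑ i, f i * lazyStep G D f i := by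
    rw [sum_mul_lazyStep_self, energy_sub_const, energy_indicator]
    have : (16 * D * q ^ 2 * arcs G S Sᶜ : ℝ) < #S := by exact_mod_cast hlt
    have : (arcs G S Sᶜ : ℝ) ≤ 1 / (8 * D * q ^ 2) * ∑ i, f i ^ 2 := by
      rw [div_mul_eq_mul_div, one_mul, le_div_iff₀ (by positivity)]
      linarith
    linarith
  have hDq : 1 / (8 * D * (q : ℝ) ^ 2) ≤ 1 := by
    rw [div_le_one (by positivity)]
    nlinarith [mul_le_mul hD' (by nlinarith : (1:ℝ) ≤ q ^ 2) (by positivity) (by positivity)]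
  have hfirst : r * ∑ i, f i ^ 2 ≤ ∑ i, lazyStep G D f i ^ 2 := by
    have hcs := sum_mul_sq_le_sq_mul_sq univ f fun i => lazyStep G D f i
    have h0 : 0 ≤ 2 * D - 1 / (8 * D * (q : ℝ) ^ 2) := by linarith
    have h2 := pow_le_pow_left₀ (mul_nonneg h0 hfpos.le) hinner 2
    have h3 : r ≤ (2 * D - 1 / (8 * D * (q : ℝ) ^ 2)) ^ 2 := by
      have : (2 * D - 1 / (8 * D * (q : ℝ) ^ 2)) ^ 2 - r = (1 / (8 * D * (q : ℝ) ^ 2)) ^ 2 := by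
        rw [hr]; field_simp; ring
      nlinarith [sq_nonneg (1 / (8 * D * (q : ℝ) ^ 2))]
    refine le_of_mul_le_mul_left ?_ hfpos
    calc (∑ i, f i ^ 2) * (r * ∑ i, f i ^ 2)
        = r * (∑ i, f i ^ 2) ^ 2 := by ring
      _ ≤ (2 * D - 1 / (8 * D * (q : ℝ) ^ 2)) ^ 2 * (∑ i, f i ^ 2) ^ 2 :=
        mul_le_mul_of_nonneg_right h3 (sq_nonneg _)
      _ ≤ _ := by rw [← mul_pow]; exact h2.trans hcs
  have hlower := pow_mul_sum_sq_le D f hrpos hfpos hfirst T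
  have hupper : ∑ v, (lazyStep G D ^ T) f v ^ 2 ≤ (∑ i, f i ^ 2) * (N * K ^ T) := by
    refine sum_sq_pow_lazyStep_le_of_sum_eq_zero f hfsum T (c := 1 / N) fun i => ?_
    have hsingle : ∑ v, ((((Pi.single i 1 : ι → ℕ) v : ℕ) : ℝ)) = 1 := by
      simp [Pi.single_apply]
    refine (sum_sq_pow_lazyStep_le hq hD hdeg (Pi.single i 1) (1 / N) ?_ T (h i)).trans ?_
    · rw [sum_sub_distrib, hsingle, sum_const, card_univ, nsmul_eq_mul, ← hN]
      field_simp; simp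
    -- A centred unit vector has squared norm `1 - 1 / N ≤ 1`.
    · refine mul_le_of_le_one_right (by positivity) ?_
      have : ∑ v, ((((Pi.single i 1 : ι → ℕ) v : ℕ) : ℝ) - 1 / N) ^ 2 =
          ∑ v, ((((Pi.single i 1 : ι → ℕ) v : ℕ) : ℝ)) * (1 - 2 * (1 / N)) +
            ∑ _v : ι, (1 / N) ^ 2 := by
        rw [← sum_add_distrib]
        refine sum_congr rfl fun v _ => ?_
        rcases eq_or_ne v i with rfl | hv
        · simp; ring
        · simp [Pi.single_eq_of_ne hv]
      rw [this, ← sum_mul, hsingle, sum_const, card_univ, nsmul_eq_mul, ← hN]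
      have : N * (1 / N) ^ 2 = 1 / N := by field_simp
      rw [this]
      have : 0 < 1 / N := by positivity
      linarith
  have hcomb : r ^ T ≤ N * K ^ T := by
    refine le_of_mul_le_mul_left ?_ hfpos
    linarith
  -- The rates differ by `1 / (2 q²)` and `K ≤ 4 D²`; by Bernoulli, `T` steps then give a ratio of
  -- at least `1 + n`, more than the factor `N` lost in `hupper`.
  have hratio : 1 + 1 / (8 * D ^ 2 * (q : ℝ) ^ 2) ≤ r / K := by
    rw [le_div_iff₀ hKpos]
    have : r = K + 1 / (2 * (q : ℝ) ^ 2) := by rw [hr, hK, hq2]; ring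
    have hKle : K ≤ 4 * D ^ 2 := by rw [hK]; linarith
    have : 1 / (8 * D ^ 2 * (q : ℝ) ^ 2) * K ≤ 1 / (8 * D ^ 2 * (q : ℝ) ^ 2) * (4 * D ^ 2) :=
      mul_le_mul_of_nonneg_left hKle (by positivity)
    have e : 1 / (8 * D ^ 2 * (q : ℝ) ^ 2) * (4 * D ^ 2) = 1 / (2 * (q : ℝ) ^ 2) := by
      field_simp; norm_num
    linarith
  have hbern := one_add_mul_le_pow (a := 1 / (8 * D ^ 2 * (q : ℝ) ^ 2))
    (le_trans (by norm_num) (by positivity : (0 : ℝ) ≤ _)) T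
  have hTn : (T : ℝ) * (1 / (8 * D ^ 2 * (q : ℝ) ^ 2)) = n := by
    rw [hT]; push_cast; field_simp
  have hpow : (1 + 1 / (8 * D ^ 2 * (q : ℝ) ^ 2)) ^ T ≤ N := by
    calc _ ≤ (r / K) ^ T := pow_le_pow_left₀ (by positivity) hratio T
      _ = r ^ T / K ^ T := div_pow _ _ _
      _ ≤ N := by rw [div_le_iff₀ (by positivity)]; exact hcomb
  have hNn : N ≤ n := by rw [hN]; exact_mod_cast hn
  rw [hTn] at hbern
  linarith

end Sweep

/-! ### The program -/

namespace Lang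

/-- The statement does not write to bank `b`. -/
def Stmt.Fixes (b : ℕ) : Stmt → Prop
  | .skip => True
  | .store b' _ _ => b ≠ b'
  | .seq p q => p.Fixes b ∧ q.Fixes b
  | .ite _ p q => p.Fixes b ∧ q.Fixes b
  | .rep p => p.Fixes b
  | .repLit _ p => p.Fixes b

theorem iter_bank {b : ℕ} {F : ℕ → Mem → Mem} (hF : ∀ k m, F k m b = m b) (k : ℕ) (m : Mem) :
    iter k F m b = m b := by
  induction k generalizing m with
  | zero => rfl
  | succ k ih => rw [iter, ih, hF]

/-- A frame rule: `Fixes` is syntactic, so unfolding the program decides which banks survive a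
statement. -/
theorem Stmt.Fixes.eval_bank {b : ℕ} {p : Stmt} (h : p.Fixes b) (n : ℕ) (v : ℕ → ℕ) (m : Mem) :
    p.eval n v m b = m b := by
  induction p generalizing v m with
  | skip => rfl
  | store b' a e => exact Function.update_of_ne h _ _
  | seq p q ihp ihq => rw [eval, ihq h.2, ihp h.1]
  | ite c p q ihp ihq =>
    rw [eval]; split_ifs
    · exact ihp h.1 v m
    · exact ihq h.2 v m
  | rep p ih => exact iter_bank (fun k m => ih h _ m) n m
  | repLit c p ih => exact iter_bank (fun k m => ih h _ m) c m

end Lang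

namespace Sweep

open Lang Lang.Expr Lang.Stmt

/-- The product of a constant with the value of an expression without loop indices. -/
def mulLit (c : ℕ) (e : Expr) : Expr := sumLit c e

/-- The adjacency matrix at the loop indices `i`, `j`. -/
def adjExpr (i j : ℕ) : Expr :=
  load 0 (add (sum (ite (sub (var (i + 1)) (var 0)) size (lit 0))) (var j))

/-- The size of the set in bank `b`. -/
def cardExpr (b : ℕ) : Expr := sum (ite (load b (var 0)) (lit 1) (lit 0))

/-- Twice the number of edges spanned by the set in bank `b`. -/
def arcsExpr (b : ℕ) : Expr :=
  sum (ite (load b (var 0))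
    (sum (ite (load b (var 0)) (ite (adjExpr 1 0) (lit 1) (lit 0)) (lit 0))) (lit 0))

/-- The number of edges between the sets in bank `4` and in bank `1`, minus bank `4`. -/
def cutExpr : Expr :=
  sum (ite (load 4 (var 0)) (sum (ite (load 1 (var 0)) (ite (load 4 (var 0)) (lit 0)
    (ite (adjExpr 1 0) (lit 1) (lit 0))) (lit 0))) (lit 0))

/-- Write `e` (in which the loop index `0` is the address) to bank `b`. -/
def fill (b : ℕ) (e : Expr) : Stmt := rep (store b (var 0) e)

/-- Assign to a scalar. -/
def assign (b : ℕ) (e : Expr) : Stmt := store b (lit 0) e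

/-- Copy bank `b` to bank `b'`. -/
def copy (b b' : ℕ) : Stmt := fill b' (load b (var 0))

/-- If the set in bank `4` is sparse, then record it in bank `5`, and put `1` into bank `8`. -/
def testStmt (q : ℕ) : Stmt :=
  .ite (sub (mulLit 2 (cardExpr 4)) (cardExpr 1)) skip
    (.ite (sub (cardExpr 4) (mulLit q cutExpr)) (seq (assign 8 (lit 1)) (copy 4 5)) skip)

/-- The superlevel set of bank `2` at the loop index `0`. -/
def upStmt : Stmt :=
  fill 4 (.ite (load 1 (var 0)) (.ite (sub (load 2 (var 1)) (load 2 (var 0))) (lit 0) (lit 1)) (lit 0))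

/-- The sublevel set of bank `2` at the loop index `0`. -/
def lowStmt : Stmt :=
  fill 4 (.ite (load 1 (var 0)) (.ite (sub (load 2 (var 0)) (load 2 (var 1))) (lit 0) (lit 1)) (lit 0))

/-- Test all level sets of bank `2`. -/
def sweepStmt (q : ℕ) : Stmt :=
  rep (.ite (load 1 (var 0)) (seq (seq upStmt (testStmt q)) (seq lowStmt (testStmt q))) skip)

/-- The new entry of the lazy walk at the loop index `0`. -/
def stepExpr (D : ℕ) : Expr :=
  sub (add (sumLit (2 * D) (load 2 (var 1)))
    (sum (.ite (load 1 (var 0)) (.ite (adjExpr 1 0) (load 2 (var 0)) (lit 0)) (lit 0))))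
    (sum (.ite (load 1 (var 0)) (.ite (adjExpr 1 0) (load 2 (var 1)) (lit 0)) (lit 0)))

/-- A step of the lazy walk. -/
def stepStmt (D : ℕ) : Stmt := seq (fill 3 (stepExpr D)) (copy 3 2)

/-- Test the level sets of the iterates of the lazy walk that starts at the loop index `0`. -/
def walkStmt (D q : ℕ) : Stmt :=
  seq (fill 2 (.ite (sub (var 0) (var 1)) (lit 0) (.ite (sub (var 1) (var 0)) (lit 0) (lit 1))))
    (repLit (8 * D ^ 2 * q ^ 2) (rep (seq (sweepStmt q) (stepStmt D))))

/-- Look for a sparse set. -/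
def searchStmt (D q : ℕ) : Stmt :=
  seq (assign 8 (lit 0)) (rep (.ite (load 1 (var 0)) (walkStmt D q) skip))

/-- Make the set in bank `1` smaller until its density is at most `a / Q`. -/
def trimStmt (a Q : ℕ) : Stmt :=
  rep (.ite (sub (mulLit Q (cardExpr 1)) (mulLit a size)) (store 1 (var 0) (lit 0)) skip)

/-- Replace the set in bank `1` by the one in bank `5`, or remove the latter from it. -/
def splitStmt (q C : ℕ) : Stmt :=
  .ite (sub (mulLit 2 (sumLit C (.ite (sub (sub (load 9 (lit 0)) (lit 1)) (var 0)) (cardExpr 5)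
      (lit 0)))) (mulLit q (arcsExpr 5)))
    (seq (fill 4 (.ite (load 5 (var 0)) (lit 0) (load 1 (var 0)))) (copy 4 1))
    (seq (copy 5 1) (assign 9 (sub (load 9 (lit 0)) (lit 1))))

/-- A round of the algorithm: bank `6` tells if it is done, bank `7` is the verdict. -/
def roundStmt (D q a b Q C : ℕ) : Stmt :=
  .ite (load 6 (lit 0)) skip
    (.ite (sub (mulLit Q (cardExpr 1)) (mulLit b size))
      (seq (searchStmt D q) (.ite (load 8 (lit 0)) (splitStmt q C)
        (seq (assign 6 (lit 1)) (assign 7 (lit 1)))))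
      (seq (trimStmt a Q) (assign 6 (lit 1))))

/-- The algorithm. -/
def mainStmt (D q a b Q C : ℕ) : Stmt :=
  seq (seq (assign 9 (lit C)) (fill 1 (lit 1))) (rep (roundStmt D q a b Q C))

/-! ### The values of the expressions -/

open Finset

variable {n : ℕ}

/-- The vertex set in bank `b`. -/
def bankSet (n b : ℕ) (m : Mem) : Finset (Fin n) := {v | m b v ≠ 0}

theorem mem_bankSet {b : ℕ} {m : Mem} {v : Fin n} : v ∈ bankSet n b m ↔ m b v ≠ 0 := by
  simp [bankSet]

theorem bankSet_congr {b : ℕ} {m m' : Mem} (h : m b = m' b) : bankSet n b m = bankSet n b m' := by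
  simp [bankSet, h]

/-- Bank `0` holds the adjacency matrix. -/
def HasAdj (G : SimpleGraph (Fin n)) (m : Mem) : Prop :=
  ∀ i j : Fin n, m 0 (i * n + j) ≠ 0 ↔ G.Adj i j

theorem adjExpr_eval {G : SimpleGraph (Fin n)} {m : Mem} (hm : HasAdj G m) {i j : ℕ} {v : ℕ → ℕ}
    (k l : Fin n) (hk : v i = k) (hl : v j = l) :
    (adjExpr i j).eval n v m ≠ 0 ↔ G.Adj k l := by
  rw [← hm k l]
  -- The machine cannot multiply, so the row offset is a sum with `k` nonzero terms.
  have : ∑ x ∈ range n, (if (k : ℕ) - x ≠ 0 then n else 0) = k * n := by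
    rw [← sum_filter, sum_const, smul_eq_mul, show (range n).filter (fun x => (k : ℕ) - x ≠ 0) =
      range k by ext x; have := k.2; simp only [mem_filter, mem_range]; omega, card_range]
  simp only [adjExpr, Expr.eval, push, hk, hl, this]

theorem cardExpr_eval (b : ℕ) (v : ℕ → ℕ) (m : Mem) :
    (cardExpr b).eval n v m = #(bankSet n b m) := by
  simp only [cardExpr, Expr.eval, push, bankSet, card_filter, sum_range]
  rfl

theorem mulLit_eval (c : ℕ) {e : Expr} {v : ℕ → ℕ} {m : Mem} {x : ℕ}
    (he : ∀ v, e.eval n v m = x) : (mulLit c e).eval n v m = c * x := by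
  simp [mulLit, Expr.eval, he]

theorem arcsExpr_eval {G : SimpleGraph (Fin n)} [DecidableRel G.Adj] {m : Mem} (hm : HasAdj G m)
    (b : ℕ) (v : ℕ → ℕ) :
    (arcsExpr b).eval n v m = arcs G (bankSet n b m) (bankSet n b m) := by
  simp only [arcsExpr, Expr.eval, push, bankSet, arcs, sum_filter, sum_range]
  refine sum_congr rfl fun i _ => ?_
  split_ifs
  swap
  · rfl
  refine sum_congr rfl fun j _ => ?_
  simp only [adjExpr_eval (v := push j (push i v)) (i := 1) (j := 0) hm i j rfl rfl]

theorem cutExpr_eval {G : SimpleGraph (Fin n)} [DecidableRel G.Adj] {m : Mem} (hm : HasAdj G m)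
    (v : ℕ → ℕ) :
    cutExpr.eval n v m = arcs G (bankSet n 4 m) (bankSet n 1 m \ bankSet n 4 m) := by
  have : bankSet n 1 m \ bankSet n 4 m = ({v | m 1 v ≠ 0 ∧ ¬ m 4 v ≠ 0} : Finset (Fin n)) := by
    ext; simp [bankSet]
  rw [this]
  simp only [cutExpr, Expr.eval, push, bankSet, arcs, sum_filter, sum_range]
  refine sum_congr rfl fun i _ => ?_
  split_ifs
  swap
  · rfl
  refine sum_congr rfl fun j _ => ?_
  simp only [adjExpr_eval (v := push j (push i v)) (i := 1) (j := 0) hm i j rfl rfl]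
  split_ifs <;> simp_all

theorem fill_eval {b : ℕ} {e : Expr} {v : ℕ → ℕ} {m : Mem}
    (he : ∀ k m g, e.eval n (push k v) (Function.update m b g) = e.eval n (push k v) m) :
    (fill b e).eval n v m =
      Function.update m b fun a => if a < n then e.eval n (push a v) m else m b a :=
  iter_update b (fun k m => e.eval n (push k v) m) he n m

theorem fill_eval_apply {b : ℕ} {e : Expr} {v : ℕ → ℕ} {m : Mem}
    (he : ∀ k m g, e.eval n (push k v) (Function.update m b g) = e.eval n (push k v) m)
    (i : Fin n) : (fill b e).eval n v m b i = e.eval n (push i v) m := by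
  rw [fill_eval he]; simp

theorem copy_eval_apply {b b' : ℕ} (hb : b ≠ b') (v : ℕ → ℕ) (m : Mem) (i : Fin n) :
    (copy b b').eval n v m b' i = m b i :=
  fill_eval_apply (fun k m g => by simp [Expr.eval, Function.update_of_ne hb]) i

theorem assign_eval (b : ℕ) (e : Expr) (v : ℕ → ℕ) (m : Mem) :
    (assign b e).eval n v m b 0 = e.eval n v m := by
  simp [assign, Stmt.eval, Expr.eval]

end Sweep

/-! ### Correctness of the search for a sparse cut. -/

namespace Sweep

open Lang Finset
open Lang.Expr (load lit var size sub add)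

variable {n : ℕ} {G : SimpleGraph (Fin n)} [DecidableRel G.Adj]

/-- `W` is a set of at most half of the vertices of `U` with few neighbours in `U`. -/
def Sparse (G : SimpleGraph (Fin n)) [DecidableRel G.Adj] (q : ℕ) (U W : Finset (Fin n)) : Prop :=
  W ⊆ U ∧ 2 * #W ≤ #U ∧ q * arcs G W (U \ W) < #W

/-- The state of the search in `U`: either a sparse set has been found, or `P` holds. -/
structure Searching (G : SimpleGraph (Fin n)) [DecidableRel G.Adj] (q : ℕ) (U : Finset (Fin n))
    (P : Prop) (m : Mem) : Prop where
  adj : HasAdj G m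
  set : bankSet n 1 m = U
  found : m 8 0 ≠ 0 → Sparse G q U (bankSet n 5 m)
  none : m 8 0 = 0 → P

variable {q : ℕ} {U : Finset (Fin n)} {P P' : Prop} {m m' : Mem}

omit [DecidableRel G.Adj] in
theorem HasAdj.congr (h : HasAdj G m) (h0 : m' 0 = m 0) : HasAdj G m' := by
  unfold HasAdj; rw [h0]; exact h

theorem Searching.congr (h : Searching G q U P m) (h0 : m' 0 = m 0) (h1 : m' 1 = m 1)
    (h5 : m' 5 = m 5) (h8 : m' 8 = m 8) : Searching G q U P m' :=
  ⟨h.adj.congr h0, (bankSet_congr h1).trans h.set,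
    fun hf => by rw [bankSet_congr h5]; exact h.found (h8 ▸ hf), fun hf => h.none (h8 ▸ hf)⟩

theorem Searching.imp (h : Searching G q U P m) (hP : P → P') : Searching G q U P' m :=
  ⟨h.adj, h.set, h.found, fun hf => hP (h.none hf)⟩

/-- `P` collects what is known while nothing has been found. Once the flag in bank `8` is set,
`none` is vacuous, so the search need not stop early. -/
theorem testStmt_spec (h : Searching G q U P m) (hsub : bankSet n 4 m ⊆ U) (v : ℕ → ℕ) :
    Searching G q U (P ∧ ¬ Sparse G q U (bankSet n 4 m)) ((testStmt q).eval n v m) := by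
  have e1 : (sub (mulLit 2 (cardExpr 4)) (cardExpr 1)).eval n v m = 2 * #(bankSet n 4 m) - #U := by
    rw [Expr.eval, mulLit_eval 2 fun v => cardExpr_eval 4 v m, cardExpr_eval, h.set]
  have e2 : (sub (cardExpr 4) (mulLit q cutExpr)).eval n v m =
      #(bankSet n 4 m) - q * arcs G (bankSet n 4 m) (U \ bankSet n 4 m) := by
    rw [Expr.eval, mulLit_eval q fun v => cutExpr_eval h.adj v, cardExpr_eval, h.set]
  rw [testStmt, Stmt.eval, e1]
  split_ifs with h1
  · exact h.imp fun hP => ⟨hP, fun hs => by have := hs.2.1; omega⟩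
  rw [Stmt.eval, e2]
  split_ifs with h2
  · have hfix : ∀ b, b = 0 ∨ b = 1 ∨ b = 4 →
        ((Lang.Stmt.seq (assign 8 (lit 1)) (copy 4 5)).eval n v m) b = m b := by
      rintro b hb
      refine Stmt.Fixes.eval_bank ?_ n v m
      simp only [Stmt.Fixes, assign, copy, fill]; omega
    have h8 : ((Lang.Stmt.seq (assign 8 (lit 1)) (copy 4 5)).eval n v m) 8 0 = 1 := by
      rw [Stmt.eval, Stmt.Fixes.eval_bank (p := copy 4 5) (by simp [Stmt.Fixes, copy, fill]),
        assign_eval, Expr.eval]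
    have h5 : bankSet n 5 ((Lang.Stmt.seq (assign 8 (lit 1)) (copy 4 5)).eval n v m) =
        bankSet n 4 m := by
      ext x
      rw [mem_bankSet, mem_bankSet, Stmt.eval, copy_eval_apply (by norm_num),
        Stmt.Fixes.eval_bank (p := assign 8 (lit 1)) (by simp [Stmt.Fixes, assign])]
    refine ⟨h.adj.congr (hfix 0 (by simp)), (bankSet_congr (hfix 1 (by simp))).trans h.set,
      fun _ => ?_, fun hf => by simp [h8] at hf⟩
    rw [h5]
    exact ⟨hsub, by omega, by omega⟩
  · exact h.imp fun hP => ⟨hP, fun hs => by have := hs.2.2; omega⟩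

theorem testStmt_bank {b : ℕ} (hb : b ≠ 5) (hb' : b ≠ 8) (v : ℕ → ℕ) (m : Mem) :
    (testStmt q).eval n v m b = m b :=
  Stmt.Fixes.eval_bank (by simp [Stmt.Fixes, testStmt, assign, copy, fill, hb, hb']) n v m

/-- The superlevel set of `x` at `u`, within `U`. -/
def upSet (U : Finset (Fin n)) (x : ℕ → ℕ) (u : ℕ) : Finset (Fin n) := {v ∈ U | x u ≤ x v}

/-- The sublevel set of `x` at `u`, within `U`. -/
def lowSet (U : Finset (Fin n)) (x : ℕ → ℕ) (u : ℕ) : Finset (Fin n) := {v ∈ U | x v ≤ x u}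

theorem upStmt_spec (h : bankSet n 1 m = U) (v : ℕ → ℕ) :
    bankSet n 4 (upStmt.eval n v m) = upSet U (m 2) (v 0) := by
  ext x
  rw [mem_bankSet, upStmt, fill_eval_apply (fun k m g => rfl), upSet, mem_filter,
    ← h, mem_bankSet]
  by_cases h1 : m 1 x = 0 <;> simp [Expr.eval, h1, Nat.sub_eq_zero_iff_le]

theorem lowStmt_spec (h : bankSet n 1 m = U) (v : ℕ → ℕ) :
    bankSet n 4 (lowStmt.eval n v m) = lowSet U (m 2) (v 0) := by
  ext x
  rw [mem_bankSet, lowStmt, fill_eval_apply (fun k m g => rfl), lowSet, mem_filter,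
    ← h, mem_bankSet]
  by_cases h1 : m 1 x = 0 <;> simp [Expr.eval, h1, Nat.sub_eq_zero_iff_le]

/-- No level set of `x` is sparse. -/
def NoSparseLevel (G : SimpleGraph (Fin n)) [DecidableRel G.Adj] (q : ℕ) (U : Finset (Fin n))
    (x : ℕ → ℕ) (u : ℕ) : Prop :=
  ¬ Sparse G q U (upSet U x u) ∧ ¬ Sparse G q U (lowSet U x u)

theorem levels_spec (h : Searching G q U P m) (v : ℕ → ℕ) :
    Searching G q U (P ∧ NoSparseLevel G q U (m 2) (v 0))
      ((((upStmt.seq (testStmt q)).seq (lowStmt.seq (testStmt q)))).eval n v m) := by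
  have hup : ∀ (m : Mem) b, b ≠ 4 → upStmt.eval n v m b = m b := fun m b hb =>
    Stmt.Fixes.eval_bank (by simpa [Stmt.Fixes, upStmt, fill] using hb) n v m
  have hlow : ∀ (m : Mem) b, b ≠ 4 → lowStmt.eval n v m b = m b := fun m b hb =>
    Stmt.Fixes.eval_bank (by simpa [Stmt.Fixes, lowStmt, fill] using hb) n v m
  simp only [Stmt.eval]
  set m₁ := upStmt.eval n v m with hm₁
  have h₁ : Searching G q U P m₁ := h.congr (hup m 0 (by simp)) (hup m 1 (by simp))
    (hup m 5 (by simp)) (hup m 8 (by simp))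
  have s₁ : bankSet n 4 m₁ = upSet U (m 2) (v 0) := upStmt_spec h.set v
  have h₂ := testStmt_spec h₁ (s₁ ▸ filter_subset _ _) v
  rw [s₁] at h₂
  set m₂ := (testStmt q).eval n v m₁ with hm₂
  have hx : m₂ 2 = m 2 := (testStmt_bank (by simp) (by simp) v m₁).trans (hup m 2 (by simp))
  set m₃ := lowStmt.eval n v m₂ with hm₃
  have h₃ : Searching G q U _ m₃ := h₂.congr (hlow m₂ 0 (by simp)) (hlow m₂ 1 (by simp))
    (hlow m₂ 5 (by simp)) (hlow m₂ 8 (by simp))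
  have s₃ : bankSet n 4 m₃ = lowSet U (m 2) (v 0) := hx ▸ lowStmt_spec h₂.set v
  have h₄ := testStmt_spec h₃ (s₃ ▸ filter_subset _ _) v
  rw [s₃] at h₄
  exact h₄.imp fun hP => ⟨hP.1.1, hP.1.2, hP.2⟩

theorem sweepStmt_bank {b : ℕ} (hb : b ≠ 4) (hb' : b ≠ 5) (hb'' : b ≠ 8) (v : ℕ → ℕ) (m : Mem) :
    (sweepStmt q).eval n v m b = m b :=
  Stmt.Fixes.eval_bank
    (by simp [Stmt.Fixes, sweepStmt, testStmt, upStmt, lowStmt, assign, copy, fill, *]) n v m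

theorem sweepStmt_spec (h : Searching G q U P m) (v : ℕ → ℕ) :
    Searching G q U (P ∧ ∀ u ∈ U, NoSparseLevel G q U (m 2) u) ((sweepStmt q).eval n v m) := by
  -- The bound on `u` is the loop index in the invariant; it becomes empty at `0`.
  refine Searching.imp (P := P ∧ ∀ u ∈ U, 0 ≤ (u : ℕ) → NoSparseLevel G q U (m 2) u) ?_
    fun hP => ⟨hP.1, fun u hu => hP.2 u hu (Nat.zero_le _)⟩
  refine (iter_induction (fun k m' => Searching G q U
    (P ∧ ∀ u ∈ U, k ≤ (u : ℕ) → NoSparseLevel G q U (m 2) u) m' ∧ m' 2 = m 2)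
      ⟨h.imp fun hP => ⟨hP, fun u _ hu => absurd u.2 (by omega)⟩, rfl⟩ ?_).1
  rintro k hk m' ⟨hm', hx⟩
  rw [Stmt.eval]
  have hlt : ∀ u : Fin n, k ≤ u → u ≠ ⟨k, hk⟩ → k + 1 ≤ u := fun u hu hne =>
    Nat.lt_of_le_of_ne hu fun h => hne (Fin.ext h.symm)
  have hmem : (load 1 (var 0)).eval n (push k v) m' ≠ 0 ↔ (⟨k, hk⟩ : Fin n) ∈ U := by
    rw [← hm'.set, mem_bankSet]; simp [Expr.eval]
  simp only [hmem]
  split_ifs with hU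
  · have h' := levels_spec hm' (push k v)
    rw [hx] at h'
    refine ⟨h'.imp fun hP => ⟨hP.1.1, fun u hu hku => ?_⟩, ?_⟩
    · by_cases hu' : u = ⟨k, hk⟩
      · subst hu'; exact hP.2
      · exact hP.1.2 u hu (hlt u hku hu')
    · rw [← hx]
      exact Stmt.Fixes.eval_bank
        (by simp [Stmt.Fixes, testStmt, upStmt, lowStmt, assign, copy, fill]) n _ m'
  · refine ⟨hm'.imp fun hP => ⟨hP.1, fun u hu hku => hP.2 u hu (hlt u hku ?_)⟩, hx⟩
    rintro rfl
    exact hU hu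

/-- The type of the elements of `U`. -/
abbrev Within (U : Finset (Fin n)) : Type := (U : Set (Fin n))

/-- The subgraph of `G` induced by `U`. -/
abbrev inducedOn (G : SimpleGraph (Fin n)) (U : Finset (Fin n)) : SimpleGraph (Within U) :=
  G.induce (U : Set (Fin n))

theorem sum_coe {M : Type*} [AddCommMonoid M] (U : Finset (Fin n)) (f : Fin n → M) :
    ∑ i : Within U, f i = ∑ i ∈ U, f i := sum_coe_sort U f

theorem card_filter_coe (U : Finset (Fin n)) (p : Fin n → Prop) [DecidablePred p] :
    #{i : Within U | p i} = #{i ∈ U | p i} := by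
  simp only [card_filter]
  exact sum_coe U fun i => if p i then 1 else 0

theorem arcs_filter_coe (U : Finset (Fin n)) (p p' : Fin n → Prop) [DecidablePred p]
    [DecidablePred p'] :
    arcs (inducedOn G U) {i : Within U | p i} {i : Within U | p' i} =
      arcs G {i ∈ U | p i} {i ∈ U | p' i} := by
  simp only [arcs, sum_filter, SimpleGraph.comap_adj, Function.Embedding.subtype_apply]
  rw [← sum_coe U]
  refine sum_congr rfl fun i _ => ?_
  rw [← sum_coe U]

theorem levelsExpand_of_noSparseLevel {x : ℕ → ℕ} (h : ∀ u ∈ U, NoSparseLevel G q U x u)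
    {X : Within U → ℕ} (hX : ∀ i : Within U, x (i : Fin n) = X i) :
    LevelsExpand (inducedOn G U) q X := by
  intro u
  simp only [← hX]
  have hcard : Fintype.card (Within U) = #U := Fintype.card_coe U
  have hu := h u u.2
  rw [hcard, card_filter_coe U fun i => x u ≤ x i, card_filter_coe U fun i => x i ≤ x u,
    arcs_filter_coe U (fun i => x u ≤ x i) fun i => ¬ x u ≤ x i,
    arcs_filter_coe U (fun i => x i ≤ x u) fun i => ¬ x i ≤ x u, filter_not, filter_not]
  refine ⟨fun h2 => ?_, fun h2 => ?_⟩
  · by_contra! hlt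
    exact hu.1 ⟨filter_subset _ _, h2, hlt⟩
  · by_contra! hlt
    exact hu.2 ⟨filter_subset _ _, h2, hlt⟩

theorem stepStmt_bank {b D : ℕ} (hb : b ≠ 2) (hb' : b ≠ 3) (v : ℕ → ℕ) (m : Mem) :
    (stepStmt D).eval n v m b = m b :=
  Stmt.Fixes.eval_bank (by simp [Stmt.Fixes, stepStmt, copy, fill, *]) n v m

/-- The tests on bank `1` drop all terms outside `U`, so the walk on the induced subgraph needs no
relabelling. The entries of bank `2` outside `U` are arbitrary. -/
theorem stepExpr_eval {D : ℕ} (hadj : HasAdj G m) (hU : bankSet n 1 m = U)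
    {X : Within U → ℕ} (hX : ∀ i : Within U, m 2 (i : Fin n) = X i) (v : ℕ → ℕ)
    (i : Within U) :
    (stepExpr D).eval n (push (i : Fin n) v) m = natStep (inducedOn G U) D X i := by
  have hmem : ∀ j : Fin n, m 1 j ≠ 0 ↔ j ∈ U := fun j => by rw [← hU, mem_bankSet]
  have key : ∀ f : ℕ → ℕ, (∑ k ∈ range n, if m 1 k ≠ 0 then
      (if (adjExpr 1 0).eval n (push k (push (i : Fin n) v)) m ≠ 0 then f k else 0) else 0) =
      ∑ j : Within U, if (inducedOn G U).Adj i j then f (j : Fin n) else 0 := by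
    intro f
    have hs := sum_coe U fun j => if G.Adj i j then f (j : Fin n) else 0
    refine Eq.trans ?_ hs.symm
    rw [sum_range, ← sum_filter_add_sum_filter_not univ (fun j => j ∈ U), filter_mem_eq_inter,
      univ_inter]
    rw [sum_eq_zero (s := univ.filter fun j => ¬ j ∈ U), add_zero]
    · refine sum_congr rfl fun j hj => ?_
      simp only [adjExpr_eval (v := push j (push (i : Fin n) v)) (i := 1) (j := 0) hadj i j rfl rfl,
        (hmem j).2 hj, if_true, ne_eq, not_false_eq_true]
    · intro j hj
      have : ¬ m 1 j ≠ 0 := fun h => (mem_filter.1 hj).2 ((hmem j).1 h)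
      rw [if_neg this]
  have k1 := key (m 2)
  have k2 := key fun _ => m 2 (i : Fin n)
  simp only [hX] at k1 k2
  rw [natStep, ← k1, ← k2]
  simp [stepExpr, Expr.eval, hX]

theorem stepStmt_spec {D : ℕ} (h : Searching G q U P m) {X : Within U → ℕ}
    (hX : ∀ i : Within U, m 2 (i : Fin n) = X i) (v : ℕ → ℕ) :
    Searching G q U P ((stepStmt D).eval n v m) ∧
      ∀ i : Within U, (stepStmt D).eval n v m 2 (i : Fin n) = natStep (inducedOn G U) D X i := by
  refine ⟨h.congr (stepStmt_bank (by simp) (by simp) v m) (stepStmt_bank (by simp) (by simp) v m)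
    (stepStmt_bank (by simp) (by simp) v m) (stepStmt_bank (by simp) (by simp) v m), fun i => ?_⟩
  rw [stepStmt, Stmt.eval, copy_eval_apply (by norm_num), fill_eval_apply, stepExpr_eval h.adj h.set hX]
  exact fun k m g => rfl

theorem walkStmt_spec {D : ℕ} (h : Searching G q U P m) (i : Within U) (v : ℕ → ℕ) :
    Searching G q U (P ∧ ∀ t < 8 * D ^ 2 * q ^ 2 * n,
      LevelsExpand (inducedOn G U) q ((natStep (inducedOn G U) D)^[t] (Pi.single i 1)))
      ((walkStmt D q).eval n (push (i : Fin n) v) m) := by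
  rw [walkStmt, Stmt.eval]
  set w := push (i : Fin n) v with hw
  set e : Expr := (.ite (sub (var 0) (var 1)) (lit 0) (.ite (sub (var 1) (var 0)) (lit 0) (lit 1)))
    with he
  set m₀ := (fill 2 e).eval n w m with hm₀
  have hfix : ∀ b, b ≠ 2 → m₀ b = m b := fun b hb =>
    Stmt.Fixes.eval_bank (by simpa [Stmt.Fixes, fill] using hb) n w m
  have h₀ : Searching G q U P m₀ :=
    h.congr (hfix 0 (by simp)) (hfix 1 (by simp)) (hfix 5 (by simp)) (hfix 8 (by simp))
  have hX₀ : ∀ j : Within U, m₀ 2 ((j : Fin n) : ℕ) =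
      (Pi.single i 1 : Within U → ℕ) j := by
    intro j
    rw [hm₀, fill_eval_apply (fun k m g => rfl)]
    rcases eq_or_ne j i with rfl | hne
    · simp [he, hw, Expr.eval]
    · rw [Pi.single_eq_of_ne hne]
      have : ((j : Fin n) : ℕ) ≠ ((i : Fin n) : ℕ) := fun h => hne (Subtype.ext (Fin.ext h))
      simp only [he, hw, Expr.eval, push_zero, push_one]
      by_cases h : ((j : Fin n) : ℕ) - ((i : Fin n) : ℕ) ≠ 0
      · exact if_pos h
      · exact (if_neg h).trans (if_pos (by omega))
  set F : Mem → Mem := fun m => ((sweepStmt q).seq (stepStmt D)).eval n w m with hF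
  have hbody : ∀ k l : ℕ, ∀ m, ((sweepStmt q).seq (stepStmt D)).eval n (push k (push l w)) m =
      F m := by
    intro k l m
    rfl
  -- A loop of constant length around one of length `n` realises all steps of the walk; the body
  -- ignores both indices.
  have hiter : Stmt.eval n (.repLit (8 * D ^ 2 * q ^ 2) (.rep ((sweepStmt q).seq (stepStmt D)))) w m₀
      = F^[8 * D ^ 2 * q ^ 2 * n] m₀ := by
    simp only [Stmt.eval] at hbody ⊢
    simp only [hbody]
    simp only [iter_const, mul_comm _ n, Function.iterate_mul]
  rw [hiter]
  have hind : ∀ T, Searching G q U (P ∧ ∀ t < T,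
      LevelsExpand (inducedOn G U) q ((natStep (inducedOn G U) D)^[t] (Pi.single i 1))) (F^[T] m₀) ∧
      ∀ j : Within U, (F^[T] m₀) 2 ((j : Fin n) : ℕ) =
        ((natStep (inducedOn G U) D)^[T] (Pi.single i 1)) j := by
    intro T
    induction T with
    | zero => exact ⟨h₀.imp fun hP => ⟨hP, by simp⟩, hX₀⟩
    | succ T ih =>
      simp only [Function.iterate_succ_apply']
      obtain ⟨ih, ihX⟩ := ih
      have hs := sweepStmt_spec ih w
      have hs' := stepStmt_spec (D := D) hs (X := (natStep (inducedOn G U) D)^[T] (Pi.single i 1))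
        (fun j => by rw [sweepStmt_bank (by simp) (by simp) (by simp)]; exact ihX j) w
      refine ⟨hs'.1.imp fun hP => ⟨hP.1.1, fun t ht => ?_⟩, hs'.2⟩
      rcases Nat.lt_succ_iff_lt_or_eq.1 ht with ht | rfl
      · exact hP.1.2 t ht
      · exact levelsExpand_of_noSparseLevel hP.2 ihX
  exact (hind _).1

theorem searchStmt_spec {D : ℕ} (hadj : HasAdj G m) (hU : bankSet n 1 m = U) (v : ℕ → ℕ) :
    Searching G q U (∀ i : Within U, ∀ t < 8 * D ^ 2 * q ^ 2 * n,
      LevelsExpand (inducedOn G U) q ((natStep (inducedOn G U) D)^[t] (Pi.single i 1)))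
      ((searchStmt D q).eval n v m) := by
  rw [searchStmt, Stmt.eval]
  set m₀ := (assign 8 (lit 0)).eval n v m with hm₀
  have hfix : ∀ b, b ≠ 8 → m₀ b = m b := fun b hb =>
    Stmt.Fixes.eval_bank (by simpa [Stmt.Fixes, assign] using hb) n v m
  have h8 : m₀ 8 0 = 0 := by rw [hm₀, assign_eval, Expr.eval]
  have h₀ : Searching G q U True m₀ := ⟨hadj.congr (hfix 0 (by simp)),
    (bankSet_congr (hfix 1 (by simp))).trans hU, fun h => absurd h8 h, fun _ => trivial⟩
  refine (iter_induction (fun k m' => Searching G q U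
    (∀ i : Within U, k ≤ ((i : Fin n) : ℕ) → ∀ t < 8 * D ^ 2 * q ^ 2 * n,
      LevelsExpand (inducedOn G U) q ((natStep (inducedOn G U) D)^[t] (Pi.single i 1))) m')
      (h₀.imp fun _ u hu => absurd (u : Fin n).2 (by omega)) ?_).imp
    fun hP i => hP i (Nat.zero_le _)
  intro k hk m' hm'
  rw [Stmt.eval]
  have hlt : ∀ u : Fin n, k ≤ u → u ≠ ⟨k, hk⟩ → k + 1 ≤ u := fun u hu hne =>
    Nat.lt_of_le_of_ne hu fun h => hne (Fin.ext h.symm)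
  have hmem : (load 1 (var 0)).eval n (push k v) m' ≠ 0 ↔ (⟨k, hk⟩ : Fin n) ∈ U := by
    rw [← hm'.set, mem_bankSet]; simp [Expr.eval]
  simp only [hmem]
  split_ifs with hkU
  · refine (walkStmt_spec (D := D) hm' ⟨⟨k, hk⟩, hkU⟩ v).imp fun hP u hku => ?_
    by_cases hu' : (u : Fin n) = ⟨k, hk⟩
    · obtain ⟨u, hu⟩ := u
      subst hu'
      exact hP.2
    · exact hP.1 u (hlt u hku hu')
  · refine hm'.imp fun hP u hku => hP u (hlt u hku ?_)
    intro h
    exact hkU (h ▸ u.2)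

end Sweep

/-! ### Trimming, splitting and the invariant of the algorithm. -/

namespace Sweep

open Lang Finset
open Lang.Expr (load lit var size sub add)

variable {n : ℕ} {G : SimpleGraph (Fin n)} [DecidableRel G.Adj]
variable {q : ℕ} {m m' : Mem}

theorem trimStmt_spec (a Q : ℕ) (v : ℕ → ℕ) (m : Mem) :
    bankSet n 1 ((trimStmt a Q).eval n v m) ⊆ bankSet n 1 m ∧
      Q * #(bankSet n 1 ((trimStmt a Q).eval n v m)) ≤ a * n ∧
      (bankSet n 1 ((trimStmt a Q).eval n v m) = bankSet n 1 m ∨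
        a * n < Q * (#(bankSet n 1 ((trimStmt a Q).eval n v m)) + 1)) := by
  set U := bankSet n 1 m
  rw [show (trimStmt a Q).eval n v m = iter n (fun k => Stmt.eval n
    (.ite (sub (mulLit Q (cardExpr 1)) (mulLit a size)) (.store 1 (var 0) (lit 0)) .skip)
    (push k v)) m from rfl]
  have h := iter_induction (F := fun k => Stmt.eval n
    (.ite (sub (mulLit Q (cardExpr 1)) (mulLit a size)) (.store 1 (var 0) (lit 0)) .skip)
    -- If the set is still too large when the index is `k`, every vertex from `k` on has been
    -- deleted. So a set still too large at `0` would be empty.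
    (push k v)) (k := n) (m := m) (fun k m' => bankSet n 1 m' ⊆ U ∧
      (bankSet n 1 m' = U ∨ a * n < Q * (#(bankSet n 1 m') + 1)) ∧
      (Q * #(bankSet n 1 m') ≤ a * n ∨ ∀ x ∈ bankSet n 1 m', (x : ℕ) < k))
    ⟨Subset.rfl, Or.inl rfl, Or.inr fun x _ => x.2⟩ ?_
  · refine ⟨h.1, h.2.2.elim id fun h0 => ?_, h.2.1⟩
    rw [eq_empty_of_forall_notMem fun x hx => absurd (h0 x hx) (Nat.not_lt_zero _)]
    simp
  · rintro k hk m' ⟨hsub, heq, hsize⟩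
    have e : (sub (mulLit Q (cardExpr 1)) (mulLit a size)).eval n (push k v) m' =
        Q * #(bankSet n 1 m') - a * n := by
      rw [Expr.eval, mulLit_eval Q fun v => cardExpr_eval 1 v m',
        mulLit_eval (x := n) a fun v => by rw [Expr.eval]]
    rw [Stmt.eval, e]
    split_ifs with hc
    · have hset : bankSet n 1 (Stmt.eval n (.store 1 (var 0) (lit 0)) (push k v) m') =
          (bankSet n 1 m').erase ⟨k, hk⟩ := by
        ext x
        rw [mem_erase, mem_bankSet, mem_bankSet, Stmt.eval]
        by_cases hx : x = ⟨k, hk⟩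
        · simp [hx, Expr.eval]
        · have : (x : ℕ) ≠ k := fun h => hx (Fin.ext h)
          simp [hx, Expr.eval, Function.update_of_ne this]
      rw [hset]
      refine ⟨(erase_subset _ _).trans hsub, Or.inr ?_, Or.inr fun x hx => ?_⟩
      · have h1 := pred_card_le_card_erase (s := bankSet n 1 m') (a := ⟨k, hk⟩)
        have := Nat.mul_le_mul_left Q (show #(bankSet n 1 m') ≤ #((bankSet n 1 m').erase ⟨k, hk⟩) + 1 by omega)
        omega
      · rw [mem_erase] at hx
        have := hsize.resolve_left (by omega) x hx.2
        exact Nat.lt_of_le_of_ne (Nat.lt_succ_iff.1 this) fun h => hx.1 (Fin.ext h)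
    · exact ⟨hsub, heq, Or.inl (show Q * #(bankSet n 1 m') ≤ a * n by omega)⟩

theorem splitStmt_spec {C : ℕ} (hadj : HasAdj G m) (hC : m 9 0 ≤ C) (v : ℕ → ℕ) :
    (q * arcs G (bankSet n 5 m) (bankSet n 5 m) < 2 * ((m 9 0 - 1) * #(bankSet n 5 m)) ∧
      bankSet n 1 ((splitStmt q C).eval n v m) = bankSet n 1 m \ bankSet n 5 m ∧
      (splitStmt q C).eval n v m 9 0 = m 9 0) ∨
    (2 * ((m 9 0 - 1) * #(bankSet n 5 m)) ≤ q * arcs G (bankSet n 5 m) (bankSet n 5 m) ∧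
      bankSet n 1 ((splitStmt q C).eval n v m) = bankSet n 5 m ∧
      (splitStmt q C).eval n v m 9 0 = m 9 0 - 1) := by
  set e₁ : Expr := .sumLit C (.ite (sub (sub (load 9 (lit 0)) (lit 1)) (var 0)) (cardExpr 5) (lit 0))
    with he₁
  -- The product with a threshold known only at run time is a sum of `C` terms, all but the first `m
  -- 9 0 - 1` of which vanish; this is exact because `m 9 0 ≤ C`.
  have e1 : ∀ v, e₁.eval n v m = (m 9 0 - 1) * #(bankSet n 5 m) := by
    intro v
    simp only [he₁, Expr.eval, cardExpr_eval, push_zero]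
    rw [← sum_filter, sum_const, smul_eq_mul, show (range C).filter
      (fun x => m 9 0 - 1 - x ≠ 0) = range (m 9 0 - 1) by
        ext x; simp only [mem_filter, mem_range]; omega, card_range]
  have e2 : (sub (mulLit 2 e₁) (mulLit q (arcsExpr 5))).eval n v m =
      2 * ((m 9 0 - 1) * #(bankSet n 5 m)) - q * arcs G (bankSet n 5 m) (bankSet n 5 m) := by
    rw [Expr.eval, mulLit_eval 2 e1, mulLit_eval q fun v => arcsExpr_eval hadj 5 v]
  rw [splitStmt, Stmt.eval, e2]
  split_ifs with hc
  · refine Or.inl ⟨by omega, ?_, ?_⟩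
    · ext x
      rw [mem_sdiff, mem_bankSet, mem_bankSet, mem_bankSet, Stmt.eval, copy_eval_apply (by norm_num),
        fill_eval_apply fun k m g => rfl]
      by_cases h5 : m 5 x = 0 <;> simp [Expr.eval, h5]
    · rw [Stmt.Fixes.eval_bank (b := 9) (by simp [Stmt.Fixes, copy, fill])]
  · refine Or.inr ⟨by omega, ?_, ?_⟩
    · ext x
      rw [mem_bankSet, mem_bankSet, Stmt.eval,
        Stmt.Fixes.eval_bank (b := 1) (p := assign _ _) (by simp [Stmt.Fixes, assign]),
        copy_eval_apply (by norm_num)]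
    · rw [Stmt.eval, assign_eval]
      simp only [Expr.eval]
      rw [Stmt.Fixes.eval_bank (b := 9) (by simp [Stmt.Fixes, copy, fill])]

omit [DecidableRel G.Adj] in
theorem arcs_comm {ι : Type*} (G : SimpleGraph ι) [DecidableRel G.Adj] (S T : Finset ι) :
    arcs G S T = arcs G T S := by
  rw [arcs, arcs, sum_comm]
  simp only [G.adj_comm]

theorem arcs_eq_add_sdiff {S U : Finset (Fin n)} (h : S ⊆ U) : arcs G U U =
    arcs G S S + arcs G (U \ S) (U \ S) + 2 * arcs G S (U \ S) := by
  have h1 : ∀ T, arcs G U T = arcs G (U \ S) T + arcs G S T := fun T => (sum_sdiff h).symm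
  rw [h1, arcs_comm G (U \ S) U, arcs_comm G S U, h1, h1, arcs_comm G (U \ S) S]
  ring

theorem degree_inducedOn_le {D : ℕ} (h : ∀ i, G.degree i ≤ D) (U : Finset (Fin n))
    (i : Within U) : (inducedOn G U).degree i ≤ D := by
  refine le_trans ?_ (h i)
  rw [← SimpleGraph.card_neighborFinset_eq_degree, SimpleGraph.neighborFinset_eq_filter,
    ← SimpleGraph.card_neighborFinset_eq_degree, SimpleGraph.neighborFinset_eq_filter]
  calc _ = #{j ∈ U | G.Adj i j} := card_filter_coe U fun j => G.Adj i j
    _ ≤ _ := card_le_card (filter_subset_filter _ (subset_univ U))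

/-- The induced subgraph on `U` is an edge expander. -/
def EdgeExpands (G : SimpleGraph (Fin n)) [DecidableRel G.Adj] (c : ℕ) (U : Finset (Fin n)) : Prop :=
  ∀ S : Finset (Within U), 2 * #S ≤ #U → #S ≤ c * arcs (inducedOn G U) S Sᶜ

/-- What the algorithm guarantees when it is done. -/
structure Done (G : SimpleGraph (Fin n)) [DecidableRel G.Adj] (D q a b Q c : ℕ) (m : Mem) :
    Prop where
  dense : m 7 0 = 0 → ∃ U : Finset (Fin n), U.Nonempty ∧ bankSet n 1 m ⊆ U ∧
    Q * #(bankSet n 1 m) ≤ a * n ∧ (bankSet n 1 m = U ∨ a * n < Q * (#(bankSet n 1 m) + 1)) ∧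
    Q * #U ≤ b * n ∧ 2 * (c * #U) ≤ q * arcs G U U
  expander : m 7 0 ≠ 0 → b * n < Q * #(bankSet n 1 m) ∧
    EdgeExpands G (16 * D * q ^ 2) (bankSet n 1 m)

/-- The invariant of the algorithm while it is running, with at most `k` vertices left. -/
structure Running (G : SimpleGraph (Fin n)) [DecidableRel G.Adj] (q C H k : ℕ) (m : Mem) :
    Prop where
  adj : HasAdj G m
  done : m 6 0 = 0
  verdict : m 7 0 = 0
  nonempty : (bankSet n 1 m).Nonempty
  card_le : #(bankSet n 1 m) ≤ k
  level : ∃ h ≤ H, m 9 0 + h = C ∧ 2 ^ h * #(bankSet n 1 m) ≤ n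
  dense : 2 * (m 9 0 * #(bankSet n 1 m)) ≤ q * arcs G (bankSet n 1 m) (bankSet n 1 m)

/-- If `W` is too sparse to keep, its internal edges and the cut account for less than the current
density times `#W`, so the rest stays as dense. If `W` is kept, halving the size pays for lowering
the threshold. -/
theorem splitStmt_running {b Q C H k : ℕ} (hH : Q ≤ 2 ^ H * b) (hC : H < C)
    (hm : Running G q C H (k + 1) m) (hlarge : b * n < Q * #(bankSet n 1 m))
    (hW : Sparse G q (bankSet n 1 m) (bankSet n 5 m)) (v : ℕ → ℕ) :
    Running G q C H k ((splitStmt q C).eval n v m) := by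
  obtain ⟨h, hh, hthr, hpow⟩ := hm.level
  -- After `H` halvings the set would have at most `n / 2 ^ H ≤ b n / Q` vertices, against `hlarge`.
  have hlt : h < H := by
    by_contra! hle
    have h1 : 2 ^ H * #(bankSet n 1 m) ≤ n :=
      (Nat.mul_le_mul_right _ (Nat.pow_le_pow_right two_pos hle)).trans hpow
    have h2 : Q * #(bankSet n 1 m) ≤ b * n := by
      calc Q * #(bankSet n 1 m) ≤ 2 ^ H * b * #(bankSet n 1 m) := Nat.mul_le_mul_right _ hH
        _ = b * (2 ^ H * #(bankSet n 1 m)) := by ring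
        _ ≤ b * n := Nat.mul_le_mul_left _ h1
    omega
  have hfix : ∀ b, b = 0 ∨ b = 6 ∨ b = 7 → (splitStmt q C).eval n v m b = m b := by
    rintro b hb
    refine Stmt.Fixes.eval_bank ?_ n v m
    simp only [Stmt.Fixes, splitStmt, assign, copy, fill]; omega
  set m' := (splitStmt q C).eval n v m with hm'
  set U := bankSet n 1 m with hU
  set W := bankSet n 5 m with hWdef
  obtain ⟨hsub, hhalf, hcut⟩ := hW
  have hcard := card_sdiff_add_card_eq_card hsub
  have harcs := arcs_eq_add_sdiff (G := G) hsub
  -- The threshold is positive because `h ≤ H < C`, so the truncated decrement is exact.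
  obtain ⟨thr, hthr'⟩ : ∃ thr, m 9 0 = thr + 1 := ⟨m 9 0 - 1, by omega⟩
  have hdense := hm.dense
  have hle : #U ≤ k + 1 := hm.card_le
  rw [hthr'] at hdense
  have hpos : 0 < #W := by omega
  rcases splitStmt_spec (q := q) hm.adj (show m 9 0 ≤ C by omega) v with
    ⟨hs, hset, h9⟩ | ⟨hs, hset, h9⟩
  all_goals
    rw [← hWdef, hthr', Nat.add_sub_cancel] at hs
    rw [← hm', ← hWdef] at hset
    rw [← hm', hthr'] at h9
  · rw [← hU] at hset
    refine ⟨hm.adj.congr (hfix 0 (by simp)), by rw [hfix 6 (by simp), hm.done],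
      by rw [hfix 7 (by simp), hm.verdict], ?_, ?_, ⟨h, hh, by omega, ?_⟩, ?_⟩
    · rw [hset, ← card_pos]; omega
    · rw [hset]; omega
    · rw [hset]
      exact (Nat.mul_le_mul_left _ (card_le_card sdiff_subset)).trans hpow
    · rw [hset, h9]
      rw [harcs, ← hcard] at hdense
      nlinarith
  · refine ⟨hm.adj.congr (hfix 0 (by simp)), by rw [hfix 6 (by simp), hm.done],
      by rw [hfix 7 (by simp), hm.verdict], ?_, ?_, ⟨h + 1, hlt, by omega, ?_⟩, ?_⟩
    · rw [hset, ← card_pos]; omega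
    · rw [hset]; omega
    · rw [hset]
      calc 2 ^ (h + 1) * #W = 2 ^ h * (2 * #W) := by ring
        _ ≤ 2 ^ h * #U := Nat.mul_le_mul_left _ hhalf
        _ ≤ n := hpow
    · rw [hset, h9]
      simpa using hs

theorem roundStmt_spec {D a b Q C H k : ℕ} (hq : 0 < q) (hD : 0 < D) (hdeg : ∀ i, G.degree i ≤ D)
    (hH : Q ≤ 2 ^ H * b) (hC : H < C)
    (hm : Running G q C H (k + 1) m ∨ m 6 0 ≠ 0 ∧ Done G D q a b Q (C - H) m) (v : ℕ → ℕ) :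
    Running G q C H k ((roundStmt D q a b Q C).eval n v m) ∨
      (roundStmt D q a b Q C).eval n v m 6 0 ≠ 0 ∧
        Done G D q a b Q (C - H) ((roundStmt D q a b Q C).eval n v m) := by
  have e0 : (load 6 (lit 0)).eval n v m = m 6 0 := rfl
  rcases hm with hm | hm
  swap
  · rw [roundStmt, Stmt.eval, e0, if_pos hm.1]
    exact Or.inr hm
  have e1 : (sub (mulLit Q (cardExpr 1)) (mulLit b size)).eval n v m =
      Q * #(bankSet n 1 m) - b * n := by
    rw [Expr.eval, mulLit_eval Q fun v => cardExpr_eval 1 v m,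
      mulLit_eval (x := n) b fun v => by rw [Expr.eval]]
  rw [roundStmt, Stmt.eval, e0, if_neg (by simp [hm.done]), Stmt.eval, e1]
  split_ifs with hlarge
  · rw [Stmt.eval]
    set m₁ := (searchStmt D q).eval n v m with hm₁
    have hfix : ∀ b, b = 1 ∨ b = 6 ∨ b = 7 ∨ b = 9 → m₁ b = m b := by
      rintro b (rfl | rfl | rfl | rfl) <;>
        exact Stmt.Fixes.eval_bank (by simp [Stmt.Fixes, searchStmt, walkStmt, sweepStmt, stepStmt,
          testStmt, upStmt, lowStmt, assign, copy, fill]) n v m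
    have hs : Searching G q (bankSet n 1 m) _ m₁ := searchStmt_spec (D := D) hm.adj rfl v
    have e8 : (load 8 (lit 0)).eval n v m₁ = m₁ 8 0 := rfl
    rw [Stmt.eval, e8]
    split_ifs with hfound
    · refine Or.inl (splitStmt_running hH hC ?_ ?_ ?_ v)
      · obtain ⟨_, h6, h7, hne, hle, hlevel, hdense⟩ := hm
        rw [← hs.set] at hne hle hlevel hdense
        rw [← hfix 6 (by simp)] at h6
        rw [← hfix 7 (by simp)] at h7
        rw [← hfix 9 (by simp)] at hlevel hdense
        exact ⟨hs.adj, h6, h7, hne, hle, hlevel, hdense⟩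
      · rw [hs.set]; omega
      · rw [hs.set]; exact hs.found hfound
    · have hset : bankSet n 1 (((assign 6 (lit 1)).seq (assign 7 (lit 1))).eval n v m₁) =
          bankSet n 1 m := by
        rw [bankSet_congr (Stmt.Fixes.eval_bank (b := 1)
          (p := (assign 6 (lit 1)).seq (assign 7 (lit 1))) (by simp [Stmt.Fixes, assign]) n v m₁),
          hs.set]
      have h7 : ((assign 6 (lit 1)).seq (assign 7 (lit 1))).eval n v m₁ 7 0 = 1 := by
        rw [Stmt.eval, assign_eval, Expr.eval]
      refine Or.inr ⟨?_, fun h => by rw [h7] at h; omega, fun _ => ?_⟩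
      · rw [Stmt.eval, Stmt.Fixes.eval_bank (b := 6) (p := assign 7 _) (by simp [Stmt.Fixes, assign]),
          assign_eval, Expr.eval]
        exact one_ne_zero
      · rw [hset]
        refine ⟨by omega, fun S hS => ?_⟩
        have hcard : Fintype.card (Within (bankSet n 1 m)) = #(bankSet n 1 m) := Fintype.card_coe _
        refine card_le_arcs_of_levelsExpand hq hD (degree_inducedOn_le hdeg _)
          (n := n) ?_ (hs.none (not_not.1 hfound)) S (hcard ▸ hS)
        rw [hcard]
        exact (card_le_univ _).trans_eq (Fintype.card_fin n)
  · rw [Stmt.eval]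
    set m₁ := (trimStmt a Q).eval n v m with hm₁
    have htrim := trimStmt_spec (n := n) a Q v m
    rw [← hm₁] at htrim
    have hset : bankSet n 1 ((assign 6 (lit 1)).eval n v m₁) = bankSet n 1 m₁ :=
      bankSet_congr (Stmt.Fixes.eval_bank (by simp [Stmt.Fixes, assign]) n v m₁)
    have h7 : (assign 6 (lit 1)).eval n v m₁ 7 0 = 0 := by
      rw [Stmt.Fixes.eval_bank (b := 7) (by simp [Stmt.Fixes, assign]), hm₁,
        Stmt.Fixes.eval_bank (b := 7) (by simp [Stmt.Fixes, trimStmt]), hm.verdict]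
    refine Or.inr ⟨by rw [assign_eval, Expr.eval]; exact one_ne_zero, fun _ => ?_,
      fun h => absurd h7 h⟩
    rw [hset]
    refine ⟨bankSet n 1 m, hm.nonempty, htrim.1, htrim.2.1, htrim.2.2, by omega, ?_⟩
    obtain ⟨h, hh, hthr, -⟩ := hm.level
    refine le_trans ?_ hm.dense
    gcongr
    omega

/-- Every unfinished round loses a vertex and leaves the set nonempty, so `n` unfinished rounds are
impossible. -/
theorem mainStmt_spec {D a b Q C H : ℕ} (hq : 0 < q) (hD : 0 < D) (hdeg : ∀ i, G.degree i ≤ D)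
    (hH : Q ≤ 2 ^ H * b) (hC : H < C) (hn : 0 < n) (hadj : HasAdj G m) (h6 : m 6 0 = 0)
    (h7 : m 7 0 = 0) (hdense : 2 * (C * n) ≤ q * arcs G univ univ) (v : ℕ → ℕ) :
    Done G D q a b Q (C - H) ((mainStmt D q a b Q C).eval n v m) := by
  rw [mainStmt, Stmt.eval]
  set m₁ := ((assign 9 (lit C)).seq (fill 1 (lit 1))).eval n v m with hm₁
  have hfix : ∀ b, b = 0 ∨ b = 6 ∨ b = 7 → m₁ b = m b := by
    rintro b hb
    refine Stmt.Fixes.eval_bank ?_ n v m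
    simp only [Stmt.Fixes, assign, fill]; omega
  have h9 : m₁ 9 0 = C := by
    rw [hm₁, Stmt.eval, Stmt.Fixes.eval_bank (b := 9) (by simp [Stmt.Fixes, fill]), assign_eval,
      Expr.eval]
  have hset : bankSet n 1 m₁ = univ := by
    refine eq_univ_of_forall fun x => ?_
    rw [mem_bankSet, hm₁, Stmt.eval, fill_eval_apply fun k m g => rfl, Expr.eval]
    exact one_ne_zero
  have hcard : #(univ : Finset (Fin n)) = n := card_fin n
  have hrun : Running G q C H n m₁ := by
    refine ⟨hadj.congr (hfix 0 (by simp)), by rw [hfix 6 (by simp), h6],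
      by rw [hfix 7 (by simp), h7], ?_, ?_, ⟨0, Nat.zero_le _, by simp [h9], ?_⟩, ?_⟩
    · rw [hset, ← card_pos, hcard]; exact hn
    · rw [hset, hcard]
    · rw [hset, hcard]; simp
    · rw [hset, hcard, h9]; exact hdense
  have := iter_induction (fun k m => Running G q C H k m ∨
    m 6 0 ≠ 0 ∧ Done G D q a b Q (C - H) m) (Or.inl hrun)
    (F := fun k => (roundStmt D q a b Q C).eval n (push k v))
    fun k _ m hm => roundStmt_spec hq hD hdeg hH hC hm (push k v)
  rcases this with h | h
  · exact absurd (card_pos.2 h.nonempty) (by have := h.card_le; omega)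
  · exact h.2

end Sweep

/-! ### Edge counts, vertex expansion and the rational window around `α`. -/

namespace Sweep

open Lang Finset

section

variable {n : ℕ} {G : SimpleGraph (Fin n)} [DecidableRel G.Adj]

theorem arcs_univ {ι : Type*} [Fintype ι] (G : SimpleGraph ι) [DecidableRel G.Adj] :
    arcs G univ univ = 2 * #G.edgeFinset := by
  rw [← SimpleGraph.sum_degrees_eq_twice_card_edges, arcs]
  refine sum_congr rfl fun i _ => ?_
  rw [← card_filter, ← SimpleGraph.card_neighborFinset_eq_degree,
    SimpleGraph.neighborFinset_eq_filter]

theorem two_mul_spannedEdges (W : Finset (Fin n)) : 2 * spannedEdges G W = arcs G W W := by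
  have h := arcs_filter_coe (G := G) W (fun _ => True) fun _ => True
  simp only [filter_true] at h
  rw [← h, arcs_univ, spannedEdges, Set.ncard_eq_toFinset_card', SimpleGraph.edgeFinset]

theorem arcs_le_mul_card {D : ℕ} (hdeg : ∀ i, G.degree i ≤ D) (S T : Finset (Fin n)) :
    arcs G S T ≤ D * #S := by
  rw [arcs, mul_comm, ← smul_eq_mul]
  refine sum_le_card_nsmul _ _ _ fun i _ => (le_trans ?_ (hdeg i))
  rw [← card_filter, ← SimpleGraph.card_neighborFinset_eq_degree,
    SimpleGraph.neighborFinset_eq_filter]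
  exact card_le_card (filter_subset_filter _ (subset_univ T))

/-- Every arc that leaves `S` ends in an external neighbour, and each of these receives at most `D`
arcs. -/
theorem arcs_compl_le {ι : Type*} [Fintype ι] [DecidableEq ι] {G : SimpleGraph ι}
    [DecidableRel G.Adj] {D : ℕ} (hdeg : ∀ i, G.degree i ≤ D) (S : Finset ι) :
    arcs G S Sᶜ ≤ D * #(extNeighbors G S) := by
  rw [arcs_comm, arcs, mul_comm, ← smul_eq_mul]
  have hsub : extNeighbors G S ⊆ Sᶜ := fun j hj => by
    simp only [extNeighbors, mem_filter] at hj
    exact mem_compl.2 hj.2.1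
  rw [← sum_subset hsub]
  · refine sum_le_card_nsmul _ _ _ fun j _ => (le_trans ?_ (hdeg j))
    rw [← card_filter, ← SimpleGraph.card_neighborFinset_eq_degree,
      SimpleGraph.neighborFinset_eq_filter]
    exact card_le_card (filter_subset_filter _ (subset_univ S))
  · intro j hj hj'
    refine sum_eq_zero fun i hi => if_neg fun hadj => hj' ?_
    simp only [extNeighbors, mem_filter, mem_univ, true_and]
    exact ⟨mem_compl.1 hj, i, hi, hadj.symm⟩

theorem EdgeExpands.isExpander {c D : ℕ} (hc : 0 < c) (hD : 0 < D) (hdeg : ∀ i, G.degree i ≤ D)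
    {U : Finset (Fin n)} (h : EdgeExpands G c U) :
    IsExpander (G.induce (U : Set (Fin n))) (1 / (c * D)) := by
  intro S hS
  have hcard : Fintype.card (U : Set (Fin n)) = #U := Fintype.card_coe U
  have h2 : 2 * #S ≤ #U := by
    rw [hcard] at hS
    have : (2 * #S : ℝ) ≤ #U := by linarith
    exact_mod_cast this
  have h3 : #S ≤ c * (D * #(extNeighbors (G.induce (U : Set (Fin n))) S)) :=
    (h S h2).trans (Nat.mul_le_mul_left _ (arcs_compl_le (degree_inducedOn_le hdeg U) S))
  have h4 : (#S : ℝ) ≤ c * (D * #(extNeighbors (G.induce (U : Set (Fin n))) S)) := by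
    exact_mod_cast h3
  rw [div_mul_eq_mul_div, one_mul, div_le_iff₀ (by positivity)]
  linarith

omit [DecidableRel G.Adj] in
theorem hasAdj_graphInput [DecidableRel G.Adj] : HasAdj G (RAM.graphInput G).mem := by
  intro i j
  simp only [RAM.graphInput, true_and, ne_eq, ite_eq_right_iff, one_ne_zero, imp_false, not_not]
  constructor
  · rintro ⟨k, l, h, hadj⟩
    have hn : 0 < n := i.pos
    have h1 : (i : ℕ) = k := by
      have := congrArg (· / n) h
      simpa [Nat.add_div_of_dvd_right, Nat.mul_div_cancel _ hn, Nat.div_eq_of_lt] using this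
    have h2 : (j : ℕ) = l := by rw [h1] at h; omega
    rwa [Fin.ext h1, Fin.ext h2]
  · exact fun h => ⟨i, j, rfl, h⟩

end

/-- Rational bounds `a / Q ≤ α ≤ b / Q` that are hard to tell apart on small instances. -/
theorem exists_rational_window {α ε : ℝ} (hα : 0 < α) (hε : 0 < ε) :
    ∃ a b Q : ℕ, 0 < Q ∧ a ≤ α * Q ∧ α * Q ≤ b ∧ α * Q ≤ 2 * a ∧
      ∀ n k k' : ℕ, Q * k ≤ b * n → a * n < Q * (k' + 1) → k' < k → (k : ℝ) - k' ≤ ε * n := by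
  -- For finitely many `n`, the integers above `α * n` stay a uniform distance away from it.
  have hgap : ∀ N : ℕ, ∃ δ : ℝ, 0 < δ ∧ ∀ n < N, ∀ k : ℕ, α * n < k → α * n + δ ≤ k := by
    intro N
    induction N with
    | zero => exact ⟨1, one_pos, by simp⟩
    | succ N ih =>
      obtain ⟨δ, hδ, h⟩ := ih
      refine ⟨min δ (⌊α * N⌋₊ + 1 - α * N), lt_min hδ (by linarith [Nat.lt_floor_add_one (α * N)]),
        fun n hn k hk => ?_⟩
      rcases Nat.lt_succ_iff_lt_or_eq.1 hn with hn | rfl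
      · exact (add_le_add_right (min_le_left _ _) _).trans (h n hn k hk)
      · have : ⌊α * n⌋₊ + 1 ≤ k := (Nat.floor_lt (by positivity)).2 hk
        have : (⌊α * n⌋₊ + 1 : ℝ) ≤ k := by exact_mod_cast this
        linarith [min_le_right δ (⌊α * n⌋₊ + 1 - α * n)]
  obtain ⟨N, hN⟩ := exists_nat_gt (2 / ε)
  obtain ⟨δ, hδ, hgapN⟩ := hgap N
  obtain ⟨M, hM⟩ := exists_nat_gt (2 / ε + N / δ + 2 / α)
  -- The factorial makes every positive `n < N` divide `Q`; the factor `M` makes `Q` large against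
  -- `2 / ε`, `N / δ` and `2 / α`.
  set Q := M * N.factorial with hQ
  have hp1 : 0 < 2 / ε := by positivity
  have hp2 : 0 ≤ N / δ := by positivity
  have hp3 : 0 < 2 / α := by positivity
  have hMpos : 0 < M := by
    have : (0 : ℝ) < M := by linarith
    exact_mod_cast this
  have hQM : (M : ℝ) ≤ Q := by exact_mod_cast Nat.le_mul_of_pos_right M N.factorial_pos
  have hQpos : (0 : ℝ) < Q := by linarith
  have hQ1 : 2 ≤ ε * Q := by
    have : 2 / ε ≤ Q := by linarith
    rw [div_le_iff₀ hε] at this; linarith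
  have hQ2 : (N : ℝ) ≤ δ * Q := by
    have : N / δ ≤ Q := by linarith
    rw [div_le_iff₀ hδ] at this; linarith
  have hQ3 : 2 ≤ α * Q := by
    have : 2 / α ≤ Q := by linarith
    rw [div_le_iff₀ hα] at this; linarith
  have hfl := Nat.floor_le (show 0 ≤ α * Q by positivity)
  have hfl' := Nat.lt_floor_add_one (α * Q)
  have hce := Nat.ceil_lt_add_one (show 0 ≤ α * Q by positivity)
  have hce' := Nat.ceil_le_floor_add_one (α * Q)
  set a := ⌊α * Q⌋₊
  set b := ⌈α * Q⌉₊
  refine ⟨a, b, Q, by exact_mod_cast hQpos, hfl, Nat.le_ceil _, by linarith, ?_⟩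
  intro n k k' hk hk' hlt
  have hkR : (Q : ℝ) * k ≤ b * n := by exact_mod_cast hk
  have hkR' : (a : ℝ) * n < Q * (k' + 1) := by exact_mod_cast hk'
  rcases Nat.eq_zero_or_pos n with rfl | hn
  · have : Q * k = 0 := by simpa using hk
    have hQ' : 0 < Q := by exact_mod_cast hQpos
    rcases Nat.mul_eq_zero.1 this with h | h <;> omega
  have hnR : (0 : ℝ) < n := by exact_mod_cast hn
  rcases lt_or_ge n N with hnN | hnN
  -- For small `n`, the gap gives `k ≤ α * n`. As `n` divides `Q`, this becomes an integer
  -- inequality that survives rounding `α * Q` down to `a`, so nothing was trimmed.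
  · exfalso
    have hkα : (k : ℝ) ≤ α * n := by
      by_contra! hgt
      have h1 := hgapN n hnN k hgt
      have h2 : (n : ℝ) < N := by exact_mod_cast hnN
      have h3 : Q * (α * n + δ) ≤ Q * (k : ℝ) := mul_le_mul_of_nonneg_left h1 hQpos.le
      have h4 : (b : ℝ) * n < (α * Q + 1) * n := mul_lt_mul_of_pos_right hce hnR
      nlinarith
    obtain ⟨c, hc⟩ : n ∣ Q := (Nat.dvd_factorial hn hnN.le).mul_left M
    have hcR : (Q : ℝ) = n * c := by exact_mod_cast hc
    have h5 : c * k ≤ a := by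
      refine Nat.le_floor ?_
      push_cast
      rw [hcR]
      have : (c : ℝ) * k ≤ c * (α * n) := mul_le_mul_of_nonneg_left hkα (Nat.cast_nonneg c)
      linarith
    have h6 : Q * k ≤ a * n := by
      rw [hc]; calc n * c * k = c * k * n := by ring
        _ ≤ a * n := Nat.mul_le_mul_right n h5
    have h7 : Q * (k' + 1) ≤ Q * k := Nat.mul_le_mul_left _ hlt
    omega
  · have hnNR : (N : ℝ) ≤ n := by exact_mod_cast hnN
    have h1 : 2 ≤ ε * n := by
      have : 2 / ε ≤ n := by linarith
      rw [div_le_iff₀ hε] at this; linarith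
    have hba : (b : ℝ) ≤ a + 1 := by exact_mod_cast hce'
    have h2 : (b : ℝ) * n ≤ (a + 1) * n := mul_le_mul_of_nonneg_right hba hnR.le
    have h3 : (Q : ℝ) * (k - k') ≤ n + Q := by linarith
    have h4 : (n : ℝ) + Q ≤ Q * (ε * n) := by nlinarith
    exact le_of_mul_le_mul_left (h3.trans h4) hQpos

end Sweep

/-! ### Choice of the constants and conclusion. -/

theorem theorem2 (c₁ c₂ α Δ : ℝ) (hc : c₂ < c₁) (hc₂ : 1 < c₂) (hα₀ : 0 < α) (hα₁ : α < 1)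
    (hΔ : 0 < Δ) :
    ∃ γ : ℝ, 0 < γ ∧ ∃ (A : RAM.Program) (p : Polynomial ℕ),
      ∀ (n : ℕ) (G : SimpleGraph (Fin n)) [DecidableRel G.Adj], 0 < n →
        (G.maxDegree : ℝ) ≤ Δ → c₁ ≤ (G.edgeFinset.card : ℝ) / (n : ℝ) →
        ∃ (s : RAM.State) (t : ℕ), RAM.Exec A (RAM.graphInput G) s t ∧ t ≤ p.eval n ∧
          (¬ RAM.announcesExpander s →
            (RAM.outputSet n s).Nonempty ∧
            ((RAM.outputSet n s).card : ℝ) ≤ α * (n : ℝ) ∧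
            c₂ * ((RAM.outputSet n s).card : ℝ) ≤ (spannedEdges G (RAM.outputSet n s) : ℝ)) ∧
          (RAM.announcesExpander s →
            α * (n : ℝ) ≤ ((RAM.outputSet n s).card : ℝ) ∧
            IsExpander (G.induce (RAM.outputSet n s : Set (Fin n))) γ) := by
  open Sweep Lang Finset in
  obtain ⟨H, hH⟩ := pow_unbounded_of_one_lt (1 / α) one_lt_two
  -- Of the `H + 2` units in `q (c₁ - c₂)`, one covers rounding in `C`, `H` cover the halvings, and
  -- one is left for trimming.
  obtain ⟨q, hq⟩ := exists_nat_gt ((H + 2) / (c₁ - c₂))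
  have hc' : 0 < c₁ - c₂ := sub_pos.2 hc
  have hqR : (0 : ℝ) < q := lt_trans (by positivity) hq
  have hqpos : 0 < q := by exact_mod_cast hqR
  rw [div_lt_iff₀ hc'] at hq
  set D := ⌈Δ⌉₊ with hD
  have hDpos : 0 < D := Nat.ceil_pos.2 hΔ
  have hDR : (0 : ℝ) < D := by exact_mod_cast hDpos
  set C := ⌊(q : ℝ) * c₁⌋₊ with hC
  have hqc : 0 ≤ (q : ℝ) * c₁ := mul_nonneg hqR.le (by linarith)
  have hC1 : (C : ℝ) ≤ q * c₁ := Nat.floor_le hqc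
  have hC2 : (q : ℝ) * c₁ < C + 1 := Nat.lt_floor_add_one _
  have hqc₂ : 0 < (q : ℝ) * c₂ := mul_pos hqR (by linarith)
  have hCH : (q : ℝ) * c₂ + 1 < C - H := by linarith
  have hHC : H < C := by
    have : (H : ℝ) < C := by linarith
    exact_mod_cast this
  have hcast : ((C - H : ℕ) : ℝ) = C - H := Nat.cast_sub hHC.le
  obtain ⟨a, b, Q, hQ, ha, hb, ha2, hwin⟩ :=
    -- With this `ε`, trimming lowers `q * arcs` by at most `α * n`, which is less than `2 * #U`.
    exists_rational_window hα₀ (show 0 < α / (2 * (q * D)) by positivity)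
  have hQR : (0 : ℝ) < Q := by exact_mod_cast hQ
  have hHb : Q ≤ 2 ^ H * b := by
    have h1 : 1 ≤ 2 ^ H * α := by
      rw [div_lt_iff₀ hα₀] at hH; exact hH.le
    have : (Q : ℝ) ≤ 2 ^ H * b := by
      calc (Q : ℝ) = 1 * Q := (one_mul _).symm
        _ ≤ 2 ^ H * α * Q := mul_le_mul_of_nonneg_right h1 hQR.le
        _ = 2 ^ H * (α * Q) := by ring
        _ ≤ 2 ^ H * b := mul_le_mul_of_nonneg_left hb (by positivity)
    exact_mod_cast this
  set P := mainStmt D q a b Q C with hP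
  -- Register `0` must hold `n` until the end; only then is it overwritten by the verdict from bank
  -- `7`.
  refine ⟨1 / ((16 * D * q ^ 2 : ℕ) * D), by positivity,
    .seq (P.compile (fun _ => 0) 1) (.seq (.const 1 0) (.load 0 7 1)), P.cost + (1 + 1), ?_⟩
  intro n G _ hn hmax hdens
  have hdeg : ∀ i, G.degree i ≤ D := fun i => (G.degree_le_maxDegree i).trans (by
    have : (G.maxDegree : ℝ) ≤ D := hmax.trans (Nat.le_ceil Δ)
    exact_mod_cast this)
  have hnR : (0 : ℝ) < n := by exact_mod_cast hn
  have hbase : ∀ b, b ≠ 0 → (RAM.graphInput G).mem b 0 = 0 := fun b hb => by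
    simp [RAM.graphInput, hb]
  have hdense : 2 * (C * n) ≤ q * arcs G univ univ := by
    rw [arcs_univ]
    rw [le_div_iff₀ hnR] at hdens
    have : (C * n : ℝ) ≤ q * #G.edgeFinset := by
      calc (C * n : ℝ) ≤ q * c₁ * n := mul_le_mul_of_nonneg_right hC1 hnR.le
        _ = q * (c₁ * n) := by ring
        _ ≤ _ := mul_le_mul_of_nonneg_left hdens hqR.le
    have : C * n ≤ q * #G.edgeFinset := by exact_mod_cast this
    linarith
  have hdone := mainStmt_spec (a := a) hqpos hDpos hdeg hHb hHC hn hasAdj_graphInput (hbase 6 (by simp))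
    (hbase 7 (by simp)) hdense (fun _ => (RAM.graphInput G).reg 0)
  rw [← hP] at hdone
  set m := P.eval n (fun _ => (RAM.graphInput G).reg 0) (RAM.graphInput G).mem with hm
  have hrun : RAM.Runs (.seq (P.compile (fun _ => 0) 1) (.seq (.const 1 0) (.load 0 7 1)))
      (RAM.graphInput G) (P.cost.eval n + (1 + 1)) fun s => s.mem = m ∧ s.reg 0 = m 7 0 := by
    refine .seq (P.runs n (fun _ => 0) 1 (RAM.graphInput G) one_pos (fun _ => one_pos) rfl)
      fun s' h => .seq (.const (Q := fun s => s.mem = m ∧ s.reg 1 = 0) ⟨h.1, by simp⟩)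
        fun s'' h' => .load ⟨h'.1, by simp [h'.1, h'.2]⟩
  obtain ⟨s, t, hexec, ht, hsm, hsr⟩ := hrun
  refine ⟨s, t, hexec, by simpa using ht, ?_⟩
  have hout : RAM.outputSet n s = bankSet n 1 m := by rw [RAM.outputSet, hsm]; rfl
  rw [hout, RAM.announcesExpander, hsr]
  constructor
  · intro h
    obtain ⟨U, hU, hsub, hsize, htrim, hUb, hUdense⟩ := hdone.dense (not_not.1 h)
    set W := bankSet n 1 m with hW
    have hkpos : (0 : ℝ) < #U := by exact_mod_cast card_pos.2 hU
    have hsizeR : (Q : ℝ) * #W ≤ a * n := by exact_mod_cast hsize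
    have hUR : (2 : ℝ) * ((C - H) * #U) ≤ q * arcs G U U := by
      rw [← hcast]; exact_mod_cast hUdense
    have hU' : 2 * ((q * c₂ + 1) * #U) < q * (arcs G U U : ℝ) :=
      lt_of_lt_of_le (by nlinarith) hUR
    -- The bound is against `#U` and not only `#W`, so it also shows that the trimmed set is
    -- nonempty.
    have hkey : 2 * (q * c₂ * #U) < q * (arcs G W W : ℝ) := by
      rcases eq_or_ne W U with hWU | hWU
      · rw [hWU]; linarith
      have hss : #W < #U := card_lt_card (hsub.ssubset_of_ne hWU)
      have htr := htrim.resolve_left hWU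
      have hdiff := hwin n #U #W hUb htr hss
      have hcard := card_sdiff_add_card_eq_card hsub
      have hcardR : (#(U \ W) : ℝ) = #U - #W := by
        rw [eq_sub_iff_add_eq]; exact_mod_cast hcard
      have hsplit : arcs G U U ≤ arcs G W W + 2 * (D * #(U \ W)) := by
        have h1 := arcs_eq_add_sdiff (G := G) hsub
        have h2 := arcs_le_mul_card hdeg (U \ W) U
        have h3 : arcs G (U \ W) U = arcs G (U \ W) (U \ W) + arcs G W (U \ W) := by
          rw [arcs_comm G _ U, arcs_comm G W, arcs, ← sum_sdiff hsub, arcs_comm G _ W]; rfl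
        omega
      have hsplitR : (arcs G U U : ℝ) ≤ arcs G W W + 2 * (D * (#U - #W)) := by
        rw [← hcardR]; exact_mod_cast hsplit
      have hD1 : q * (D * (#U - #W : ℝ)) ≤ α * n / 2 := by
        calc q * (D * (#U - #W : ℝ)) = q * D * (#U - #W) := by ring
          _ ≤ q * D * (α / (2 * (q * D)) * n) := mul_le_mul_of_nonneg_left hdiff (by positivity)
          _ = α * n / 2 := by field_simp
      have hk : α * n / 2 < #U := by
        have h1 : (a * n : ℝ) < Q * (#W + 1) := by exact_mod_cast htr
        have h2 : (#W + 1 : ℝ) ≤ #U := by exact_mod_cast hss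
        have h3 : (Q : ℝ) * (#W + 1) ≤ Q * #U := mul_le_mul_of_nonneg_left h2 hQR.le
        have h4 : α * Q * n ≤ 2 * a * n := mul_le_mul_of_nonneg_right ha2 hnR.le
        refine lt_of_mul_lt_mul_left ?_ hQR.le
        linarith
      have h5 : q * (arcs G U U : ℝ) ≤ q * (arcs G W W + 2 * (D * (#U - #W))) :=
        mul_le_mul_of_nonneg_left hsplitR hqR.le
      linarith
    have hspan : (2 : ℝ) * spannedEdges G W = arcs G W W := by
      exact_mod_cast two_mul_spannedEdges (G := G) W
    have hWU : (#W : ℝ) ≤ #U := by exact_mod_cast card_le_card hsub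
    refine ⟨nonempty_iff_ne_empty.2 fun he => ?_, ?_, ?_⟩
    · rw [he, show arcs G ∅ ∅ = 0 from rfl] at hkey
      have := mul_pos hqc₂ hkpos
      simp only [Nat.cast_zero, mul_zero] at hkey
      linarith
    · have h2 : (a : ℝ) * n ≤ α * Q * n := mul_le_mul_of_nonneg_right ha hnR.le
      refine le_of_mul_le_mul_left ?_ hQR
      linarith
    · have h2 : q * c₂ * #W ≤ q * c₂ * (#U : ℝ) := mul_le_mul_of_nonneg_left hWU hqc₂.le
      refine le_of_mul_le_mul_left ?_ hqR
      rw [← hspan] at hkey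
      linarith
  · intro h
    obtain ⟨hlarge, hexp⟩ := hdone.expander h
    refine ⟨?_, hexp.isExpander (by positivity) hDpos hdeg⟩
    have : (b * n : ℝ) < Q * #(bankSet n 1 m) := by exact_mod_cast hlarge
    have h2 : α * Q * n ≤ b * n := mul_le_mul_of_nonneg_right hb hnR.le
    refine le_of_mul_le_mul_left ?_ hQR
    linarith
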